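/- Let $N\ge 1$, let $\delta_1,\dots,\delta_N\in\mathbb C$, and let $\ell_1,\dots,\ell_N\in\mathbb C$ satisfy $2\ell_k\notin\{0,-1,-2,\dots\}$ for all $k$. On $V_1\otimes\cdots\otimes V_N=\mathbb C[z_1,\dots,z_N]$ consider the transfer matrix of the inhomogeneous periodic XXX spin chain $$\mathbf t(u)=\operatorname{tr}_{\mathbb C^2}L_1(u_1^+,u_1^-)\cdots L_N(u_N^+,u_N^-),\qquad L_k(u_k^+,u_k^-)=\begin{pmatrix}u_k^++z_k\partial_k&-\partial_k\\ z_k^2\partial_k+(u_k^+-u_k^-)z_k&u_k^--z_k\partial_k\end{pmatrix},\qquad u_k^\pm=u+\delta_k\pm\ell_k .$$ On $V_0\otimes V_1\otimes\cdots\otimes V_N=\mathbb C[z_0,z_1,\dots,z_N]$ let $\mathbb P_{k0}$ exchange $z_k$ and $z_0$, put $z_{ij}=z_i-z_j$, and let $$\mathcal R^-_{k0}(u)=\frac{\Gamma(2\ell_k)}{\Gamma(u+\ell_k)}\,\frac{\Gamma(z_{k0}\partial_k+u+\ell_k)}{\Gamma(z_{k0}\partial_k+2\ell_k)},\qquad \mathcal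 R^+_{k0}(u)=\frac{\Gamma(1+\ell_k-u)}{\Gamma(2\ell_k)}\,\frac{\Gamma(z_{0k}\partial_0+2\ell_k)}{\Gamma(z_{0k}\partial_0+1+\ell_k-u)} .$$ Here a function of the diagonalizable operator $z_{k0}\partial_k$ (or $z_{0k}\partial_0$), whose eigenvalues are $n=0,1,2,\dots$, acts on the $n$-th eigenspace by its value at $n$, and $\Gamma(a+n)/\Gamma(a)$ is read as $(a)_n=a(a+1)\cdots(a+n-1)$; thus $\mathcal R^-_{k0}(u)$ is defined for all $u$, and $\mathcal R^+_{k0}(u)$ is defined when $1+\ell_k-u\notin\{0,-1,-2,\dots\}$. The trace over $V_0=\mathbb C[z_0]$ of an operator $\mathbb A$ on $\mathbb C[z_0,\dots,z_N]$ is $$\bigl(\operatorname{tr}_{V_0}\mathbb A\bigr)\Psi=\sum_{m=0}^\infty\frac1{m!}\,\partial_0^m\,\mathbb A\,z_0^m\,\Psi\Big|_{z_0=0},\qquad \Psi\in\mathbb C[z_1,\dots,z_N],$$ and is said to exist if for each $\Psi$ the series converges (absolutely, coefficient by coefficient) to a polynomial. Put $$\mathbf Q_\pm(u)=\operatorname{tr}_{V_0}\mathbb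 P_{10}\mathcal R^\pm_{10}(u+\delta_1)\cdots\mathbb P_{N0}\mathcal R^\pm_{N0}(u+\delta_N),\qquad \Delta_\pm(u)=\prod_{k=1}^N(u+\delta_k\pm\ell_k).$$ (1) For every $u\in\mathbb C$ the trace defining $\mathbf Q_-(u)$ exists, and for every $u\in\mathbb C$ $$\mathbf Q_-(u)\,\mathbf t(u)=\Delta_+(u)\,\mathbf Q_-(u+1)+\Delta_-(u)\,\mathbf Q_-(u-1).$$ (2) If $\operatorname{Re}\sum_k\ell_k>\tfrac12$, then the trace defining $\mathbf Q_+(u)$ exists for every $u$ such that all $\mathcal R^+_{k0}(u+\delta_k)$ are defined. For arbitrary $\ell_k$ as above, and for every $u\in\mathbb C$ such that for each $v\in\{u-1,u,u+1\}$ all $\mathcal R^+_{k0}(v+\delta_k)$ are defined and the trace defining $\mathbf Q_+(v)$ exists, $$\mathbf t(u)\,\mathbf Q_+(u)=\frac{\Delta_+(u-1)\,\Delta_-(u)}{\Delta_-(u-1)}\,\mathbf Q_+(u-1)+\Delta_-(u)\,\mathbf Q_+(u+1).$$ -/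

import Mathlib

open MvPolynomial

namespace SpinChain

/-- Multiplication by the variable `z_i` on `ℂ[z]`. -/
noncomputable def mulZ {σ : Type*} (i : σ) : Module.End ℂ (MvPolynomial σ ℂ) :=
  LinearMap.mulLeft ℂ (X i)

/-- The partial derivative `∂_i` on `ℂ[z]`. -/
noncomputable def del {σ : Type*} (i : σ) : Module.End ℂ (MvPolynomial σ ℂ) :=
  (pderiv (R := ℂ) i).toLinearMap

/-- The Lax operator `L_k(u₊, u₋)`, a `2 × 2` matrix of differential operators in `z_k`. -/
noncomputable def lax {σ : Type*} (k : σ) (up um : ℂ) :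
    Matrix (Fin 2) (Fin 2) (Module.End ℂ (MvPolynomial σ ℂ)) :=
  !![up • 1 + mulZ k * del k, -del k;
     mulZ k ^ 2 * del k + (up - um) • mulZ k, um • 1 - mulZ k * del k]

/-- The transfer matrix `t(u) = tr L_1(u + δ_1 + ℓ_1, u + δ_1 - ℓ_1) ⋯ L_N(u + δ_N + ℓ_N, u + δ_N - ℓ_N)`,
acting on `V_1 ⊗ ⋯ ⊗ V_N = ℂ[z_1, …, z_N]`; the trace is over the auxiliary space `ℂ²`. -/
noncomputable def transferMatrix {N : ℕ} (l δ : Fin N → ℂ) (u : ℂ) :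
    Module.End ℂ (MvPolynomial (Fin N) ℂ) :=
  (List.ofFn fun k => lax k (u + δ k + l k) (u + δ k - l k)).prod.trace

/-- The operator multiplying each monomial `z^d` by `f (d i)`, i.e. `f(z_i ∂_i)`. -/
noncomputable def eulerFun {σ : Type*} (i : σ) (f : ℕ → ℂ) :
    Module.End ℂ (MvPolynomial σ ℂ) :=
  (basisMonomials σ ℂ).constr ℂ fun d => f (d i) • monomial d 1

/-- The substitution `z_i ↦ z_i + c z_j`, all other variables being fixed. -/
noncomputable def shiftVar {σ : Type*} [DecidableEq σ] (i j : σ) (c : ℂ) :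
    Module.End ℂ (MvPolynomial σ ℂ) :=
  (aeval (R := ℂ) fun s => if s = i then X i + C c * X j else X s).toLinearMap

/-- For `i ≠ j`, the operator `f(z_{ij} ∂_i)` with `z_{ij} = z_i - z_j`. The operator `z_{ij} ∂_i` is
diagonalizable with eigenvalues `n = 0, 1, 2, …`, the `n`-th eigenspace consisting of the
`(z_i - z_j)^n g` with `g` independent of `z_i`; there `f(z_{ij} ∂_i)` acts as `f n`.
In the coordinate `z_i - z_j` in place of `z_i` it is `f(z_i ∂_i)`. -/
noncomputable def dilationFun {σ : Type*} [DecidableEq σ] (i j : σ) (f : ℕ → ℂ) :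
    Module.End ℂ (MvPolynomial σ ℂ) :=
  shiftVar i j (-1) * eulerFun i f * shiftVar i j 1

/-- The defining property of `f(z_{ij} ∂_i)`: it acts as `f n` on `(z_i - z_j)^n g`, for every
monomial `g` that does not contain `z_i`. -/
theorem dilationFun_eigen {σ : Type*} [DecidableEq σ] (i j : σ) (hij : i ≠ j) (f : ℕ → ℂ) (n : ℕ)
    (e : σ →₀ ℕ) (he : e i = 0) :
    dilationFun i j f ((X i - X j) ^ n * monomial e 1) =
      f n • ((X i - X j) ^ n * monomial e 1) := by
  have hmono : ∀ c : ℂ, shiftVar i j c (monomial e 1) = monomial e 1 := by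
    intro c
    simp only [shiftVar, AlgHom.toLinearMap_apply, aeval_monomial, map_one, one_mul]
    rw [monomial_eq, C_1, one_mul]
    refine Finsupp.prod_congr fun s hs => ?_
    have : s ≠ i := fun h => by simp [h, he] at hs
    simp [this]
  have hmul : ∀ (c : ℂ) (p q : MvPolynomial σ ℂ),
      shiftVar i j c (p * q) = shiftVar i j c p * shiftVar i j c q := by
    intro c p q; simp [shiftVar]
  have h1 : shiftVar i j 1 ((X i - X j) ^ n) = (X i : MvPolynomial σ ℂ) ^ n := by
    simp [shiftVar, hij.symm]
  have h2 : shiftVar i j (-1) ((X i : MvPolynomial σ ℂ) ^ n) = (X i - X j) ^ n := by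
    simp [shiftVar, sub_eq_add_neg]
  have h3 : eulerFun i f (X i ^ n * monomial e 1) = f n • (X i ^ n * monomial e (1 : ℂ)) := by
    have h := (basisMonomials σ ℂ).constr_basis ℂ (fun d => f (d i) • monomial d (1 : ℂ))
      (Finsupp.single i n + e)
    rw [X_pow_eq_monomial, monomial_mul, mul_one]
    simpa [eulerFun, he] using h
  rw [dilationFun, Module.End.mul_apply, Module.End.mul_apply, hmul, h1, hmono, h3, map_smul, hmul,
    h2, hmono]

/-- The polynomials `ℂ[z_0, z_1, …, z_N]`: the auxiliary variable `z_0` is `X none`, the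
variable `z_k` of the `k`-th site is `X (some k)`. -/
abbrev Extended (N : ℕ) := MvPolynomial (Option (Fin N)) ℂ

/-- The permutation operator `P_{k0}`, which exchanges `z_k` and `z_0`. -/
noncomputable def permOp {N : ℕ} (k : Fin N) : Module.End ℂ (Extended N) :=
  (rename (R := ℂ) (Equiv.swap (some k) none)).toLinearMap

/-- The quotient of Pochhammer symbols `(a)_n / (c)_n`, with `(a)_n = a (a + 1) ⋯ (a + n - 1)`. -/
noncomputable def pochRatio (a c : ℂ) (n : ℕ) : ℂ :=
  (ascPochhammer ℂ n).eval a / (ascPochhammer ℂ n).eval c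

/-- Where the Gamma functions are finite, `pochRatio` is the quotient of Gamma functions
`Γ(c)/Γ(a) · Γ(n + a)/Γ(n + c)`. -/
theorem pochRatio_eq_Gamma (a c : ℂ) (ha : ∀ m : ℕ, a ≠ -m) (hc : ∀ m : ℕ, c ≠ -m) (n : ℕ) :
    pochRatio a c n =
      Complex.Gamma c / Complex.Gamma a * (Complex.Gamma (n + a) / Complex.Gamma (n + c)) := by
  have key : ∀ b : ℂ, (∀ m : ℕ, b ≠ -m) →
      Complex.Gamma (n + b) = (ascPochhammer ℂ n).eval b * Complex.Gamma b := by
    intro b hb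
    induction n with
    | zero => simp
    | succ n ih =>
      have h : (n : ℂ) + b ≠ 0 := fun h => hb n (by linear_combination h)
      have e : ((n + 1 : ℕ) : ℂ) + b = (n + b) + 1 := by push_cast; ring
      rw [e, Complex.Gamma_add_one _ h, ih, ascPochhammer_succ_eval]
      ring
  have h1 := Complex.Gamma_ne_zero ha
  have h2 := Complex.Gamma_ne_zero hc
  have h3 : (ascPochhammer ℂ n).eval c ≠ 0 := by
    intro h0
    have h4 : Complex.Gamma (n + c) ≠ 0 :=
      Complex.Gamma_ne_zero fun m h => hc (n + m) (by push_cast; linear_combination h)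
    exact h4 (by rw [key c hc, h0, zero_mul])
  rw [key a ha, key c hc, pochRatio]
  field_simp

/-- `R⁻_{k0}(u) = Γ(2ℓ)/Γ(u + ℓ) · Γ(z_{k0}∂_k + u + ℓ)/Γ(z_{k0}∂_k + 2ℓ)`, where `ℓ = ℓ_k`. -/
noncomputable def Rminus {N : ℕ} (k : Fin N) (l u : ℂ) : Module.End ℂ (Extended N) :=
  dilationFun (some k) none (pochRatio (u + l) (2 * l))

/-- `R⁺_{k0}(u) = Γ(1 + ℓ - u)/Γ(2ℓ) · Γ(z_{0k}∂_0 + 2ℓ)/Γ(z_{0k}∂_0 + 1 + ℓ - u)`,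
where `ℓ = ℓ_k`. -/
noncomputable def Rplus {N : ℕ} (k : Fin N) (l u : ℂ) : Module.End ℂ (Extended N) :=
  dilationFun none (some k) (pochRatio (2 * l) (1 + l - u))

/-- `P_{10} R⁻_{10}(u + δ_1) ⋯ P_{N0} R⁻_{N0}(u + δ_N)`. -/
noncomputable def monodromyMinus {N : ℕ} (l δ : Fin N → ℂ) (u : ℂ) :
    Module.End ℂ (Extended N) :=
  (List.ofFn fun k => permOp k * Rminus k (l k) (u + δ k)).prod

/-- `P_{10} R⁺_{10}(u + δ_1) ⋯ P_{N0} R⁺_{N0}(u + δ_N)`. -/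
noncomputable def monodromyPlus {N : ℕ} (l δ : Fin N → ℂ) (u : ℂ) :
    Module.End ℂ (Extended N) :=
  (List.ofFn fun k => permOp k * Rplus k (l k) (u + δ k)).prod

/-- The evaluation `z_0 = 0`. -/
noncomputable def evalZero {N : ℕ} : Extended N →ₗ[ℂ] MvPolynomial (Fin N) ℂ :=
  (aeval (R := ℂ) fun s : Option (Fin N) => s.elim 0 X).toLinearMap

/-- The `m`-th diagonal term `(1/m!) ∂_0^m A z_0^m Ψ |_{z_0 = 0}` of the trace of `A` over
`V_0 = ℂ[z_0]`. -/
noncomputable def traceTerm {N : ℕ} (A : Module.End ℂ (Extended N)) (m : ℕ)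
    (Ψ : MvPolynomial (Fin N) ℂ) : MvPolynomial (Fin N) ℂ :=
  (1 / (m.factorial : ℂ)) • evalZero ((del none ^ m) (A (X none ^ m * rename some Ψ)))

/-- The trace of `A` over `V_0` exists and is the operator `T`: for every polynomial `Ψ` the series
`∑ₘ (1/m!) ∂_0^m A z_0^m Ψ |_{z_0 = 0}` converges, coefficient by coefficient, to `T Ψ`. -/
def HasPartialTrace {N : ℕ} (A : Module.End ℂ (Extended N))
    (T : Module.End ℂ (MvPolynomial (Fin N) ℂ)) : Prop :=
  ∀ (Ψ : MvPolynomial (Fin N) ℂ) (d : Fin N →₀ ℕ),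
    HasSum (fun m : ℕ => coeff d (traceTerm A m Ψ)) (coeff d (T Ψ))

open Classical in
/-- The trace of `A` over `V_0` (zero if it does not exist). -/
noncomputable def partialTrace {N : ℕ} (A : Module.End ℂ (Extended N)) :
    Module.End ℂ (MvPolynomial (Fin N) ℂ) :=
  if h : ∃ T, HasPartialTrace A T then h.choose else 0

theorem HasPartialTrace.partialTrace_eq {N : ℕ} {A : Module.End ℂ (Extended N)}
    {T : Module.End ℂ (MvPolynomial (Fin N) ℂ)} (h : HasPartialTrace A T) :
    partialTrace A = T := by
  have hex : ∃ T, HasPartialTrace A T := ⟨T, h⟩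
  rw [partialTrace, dif_pos hex]
  refine LinearMap.ext fun Ψ => MvPolynomial.ext _ _ fun d => ?_
  exact (hex.choose_spec Ψ d).unique (h Ψ d)

/-- The operator `Q₋(u)`. -/
noncomputable def Qminus {N : ℕ} (l δ : Fin N → ℂ) (u : ℂ) :
    Module.End ℂ (MvPolynomial (Fin N) ℂ) :=
  partialTrace (monodromyMinus l δ u)

/-- The operator `Q₊(u)`. -/
noncomputable def Qplus {N : ℕ} (l δ : Fin N → ℂ) (u : ℂ) :
    Module.End ℂ (MvPolynomial (Fin N) ℂ) :=
  partialTrace (monodromyPlus l δ u)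

/-- `Δ₊(u) = (u + δ_1 + ℓ_1) ⋯ (u + δ_N + ℓ_N)`. -/
noncomputable def DeltaPlus {N : ℕ} (l δ : Fin N → ℂ) (u : ℂ) : ℂ := ∏ k, (u + δ k + l k)

/-- `Δ₋(u) = (u + δ_1 - ℓ_1) ⋯ (u + δ_N - ℓ_N)`. -/
noncomputable def DeltaMinus {N : ℕ} (l δ : Fin N → ℂ) (u : ℂ) : ℂ := ∏ k, (u + δ k - l k)

end SpinChain

/-! Write `M(z)` for the lower unitriangular matrix `lowerUni z`. At each site a product of the Lax
matrix and `P_{k0} R_{k0}` becomes upper triangular under conjugation by `M(z_0)`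
(`lax_mul_permOp_mul`, `permOp_mul_mul_lax`). The vanishing of the lower left entry is a first-order
recurrence for the function of the dilation operator, solved by the quotient of Pochhammer symbols.
Contiguous relations turn the diagonal entries into multiples of the same operator at `u - 1` and `u
+ 1`.

Since `P_{k0}` makes the conjugating matrix the same at every site, the conjugations cancel between
neighbours. Lax matrices commute with the operators of other sites, so `t(u)` times the monodromy is
the trace of a conjugated triangular product. The entries do not commute with `z_0`, hence this
trace is the two diagonal products plus a commutator `[z_0, K]` (`trace_prod_of_conj`), where `K` is
the upper right entry. The diagonal products give the right side of the Baxter equation.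

The partial sums of the trace of `[z_0, K]` over `V_0` telescope to one boundary term
(`sum_traceTerm_commutator`), and it remains to show that it tends to zero. For `Q₋` the leftmost
factor bounds the power of `z_0` by a power of `z_k` that the other factors leave fixed, so both the
trace and the boundary terms are finitely supported. For `Q₊` the matrix elements near the diagonal
are known in closed form (`iterDiff_pochRatio`), and factor `k` contributes the rate `|(b - c)_m /
(b)_m| = O(m^{-2 Re ℓ_k})` with `b = 1 + ℓ_k - u - δ_k`, `c = 2ℓ_k`. The product of the rates is
summable if `Re ∑ ℓ_k > 1/2`. Without that assumption, this product at `u - 1` is the modulus of one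
diagonal term of the trace defining `Q₊(u - 1)`, so it tends to zero once that trace exists, and it
dominates the rates at `u` and `u + 1`. -/

namespace SpinChain

/-! ### Commutation rules for multiplication, differentiation and functions of dilations. -/

section Operators

variable {σ : Type*}

theorem hom_ext_monomial {V : Type*} [AddCommMonoid V] [Module ℂ V]
    {A B : MvPolynomial σ ℂ →ₗ[ℂ] V} (h : ∀ d, A (monomial d 1) = B (monomial d 1)) : A = B :=
  (basisMonomials σ ℂ).ext fun d => by simpa using h d

@[simp] theorem mulZ_apply (i : σ) (p : MvPolynomial σ ℂ) : mulZ i p = X i * p := rfl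

@[simp] theorem del_apply (i : σ) (p : MvPolynomial σ ℂ) : del i p = pderiv i p := rfl

theorem eulerFun_monomial (i : σ) (f : ℕ → ℂ) (d : σ →₀ ℕ) :
    eulerFun i f (monomial d 1) = f (d i) • monomial d 1 := by
  simpa [eulerFun] using
    (basisMonomials σ ℂ).constr_basis ℂ (fun d => f (d i) • monomial d (1 : ℂ)) d

theorem mulZ_monomial (i : σ) (d : σ →₀ ℕ) :
    mulZ i (monomial d (1 : ℂ)) = monomial (Finsupp.single i 1 + d) 1 := by
  rw [mulZ_apply, X, monomial_mul, one_mul]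

theorem del_monomial (i : σ) (d : σ →₀ ℕ) :
    del i (monomial d (1 : ℂ)) = (d i : ℂ) • monomial (d - Finsupp.single i 1) 1 := by
  rw [del_apply, pderiv_monomial, one_mul, smul_monomial, smul_eq_mul, mul_one]

theorem eulerFun_mulZ (i : σ) (f : ℕ → ℂ) :
    eulerFun i f * mulZ i = mulZ i * eulerFun i (fun n => f (n + 1)) := by
  refine hom_ext_monomial fun d => ?_
  rw [Module.End.mul_apply, Module.End.mul_apply, eulerFun_monomial, map_smul, mulZ_monomial,
    eulerFun_monomial]
  simp [add_comm 1 (d i)]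

theorem eulerFun_commute_mulZ {i s : σ} (h : s ≠ i) (f : ℕ → ℂ) :
    Commute (eulerFun i f) (mulZ s) := by
  refine hom_ext_monomial fun d => ?_
  rw [Module.End.mul_apply, Module.End.mul_apply, eulerFun_monomial, map_smul, mulZ_monomial,
    eulerFun_monomial]
  simp [h]

theorem del_mul_eulerFun (i : σ) (f : ℕ → ℂ) :
    del i * eulerFun i f = eulerFun i (fun n => f (n + 1)) * del i := by
  refine hom_ext_monomial fun d => ?_
  rw [Module.End.mul_apply, Module.End.mul_apply, eulerFun_monomial, map_smul, del_monomial,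
    map_smul, eulerFun_monomial]
  rcases Nat.eq_zero_or_pos (d i) with h | h
  · simp [h]
  · rw [smul_comm]
    simp [Nat.sub_add_cancel h]

theorem eulerFun_commute_del {i s : σ} (h : s ≠ i) (f : ℕ → ℂ) :
    Commute (eulerFun i f) (del s) := by
  refine hom_ext_monomial fun d => ?_
  rw [Module.End.mul_apply, Module.End.mul_apply, eulerFun_monomial, map_smul, del_monomial,
    map_smul, eulerFun_monomial, smul_comm]
  simp [h]

theorem eulerFun_mul (i : σ) (f g : ℕ → ℂ) :
    eulerFun i f * eulerFun i g = eulerFun i (fun n => f n * g n) := by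
  refine hom_ext_monomial fun d => ?_
  rw [Module.End.mul_apply, eulerFun_monomial, map_smul, eulerFun_monomial, eulerFun_monomial,
    smul_smul, mul_comm]

theorem eulerFun_add (i : σ) (f g : ℕ → ℂ) :
    eulerFun i (fun n => f n + g n) = eulerFun i f + eulerFun i g := by
  refine hom_ext_monomial fun d => ?_
  rw [LinearMap.add_apply]
  simp only [eulerFun_monomial, add_smul]

theorem eulerFun_smul (i : σ) (c : ℂ) (f : ℕ → ℂ) :
    eulerFun i (fun n => c * f n) = c • eulerFun i f := by
  refine hom_ext_monomial fun d => ?_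
  rw [LinearMap.smul_apply]
  simp only [eulerFun_monomial, mul_smul]

theorem eulerFun_cast (i : σ) : eulerFun i (fun n => (n : ℂ)) = mulZ i * del i := by
  refine hom_ext_monomial fun d => ?_
  rw [Module.End.mul_apply, eulerFun_monomial, del_monomial, map_smul, mulZ_monomial]
  rcases Nat.eq_zero_or_pos (d i) with h | h
  · simp [h]
  · rw [add_tsub_cancel_of_le (Finsupp.single_le_iff.2 h)]

variable [DecidableEq σ]

theorem shiftVar_mul_apply (i j : σ) (c : ℂ) (p q : MvPolynomial σ ℂ) :
    shiftVar i j c (p * q) = shiftVar i j c p * shiftVar i j c q :=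
  map_mul (aeval _) p q

theorem shiftVar_mulZ {i s : σ} (h : s ≠ i) (j : σ) (c : ℂ) :
    Commute (shiftVar i j c) (mulZ s) :=
  LinearMap.ext fun p => by
    simp only [Module.End.mul_apply, mulZ_apply, shiftVar_mul_apply]
    simp [shiftVar, h]

theorem shiftVar_mulZ_self (i j : σ) (c : ℂ) :
    shiftVar i j c * mulZ i = (mulZ i + c • mulZ j) * shiftVar i j c :=
  LinearMap.ext fun p => by
    simp only [Module.End.mul_apply, mulZ_apply, shiftVar_mul_apply, LinearMap.add_apply,
      LinearMap.smul_apply]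
    simp [shiftVar, add_mul, smul_eq_C_mul, mul_assoc]

theorem shiftVar_commute_del {j s : σ} (h : s ≠ j) (i : σ) (c : ℂ) :
    Commute (shiftVar i j c) (del s) := by
  refine LinearMap.ext fun p => ?_
  simp only [Module.End.mul_apply, del_apply]
  induction p using MvPolynomial.induction_on with
  | C a => simp [shiftVar]
  | add p q hp hq => simp only [map_add, hp, hq]
  | mul_X p t hp =>
    have hX : shiftVar i j c (pderiv s (X t)) = pderiv s (shiftVar i j c (X t)) := by
      by_cases hts : s = t
      · subst hts
        by_cases hsi : s = i
        · subst hsi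
          simp [shiftVar, pderiv_X_of_ne h.symm]
        · simp [shiftVar, hsi]
      · rw [pderiv_X_of_ne (Ne.symm hts), map_zero]
        by_cases hti : t = i
        · subst hti
          simp [shiftVar, pderiv_X_of_ne h.symm, pderiv_X_of_ne (Ne.symm hts)]
        · simp [shiftVar, hti, pderiv_X_of_ne (Ne.symm hts)]
    rw [Derivation.leibniz, map_add, smul_eq_mul, smul_eq_mul, shiftVar_mul_apply,
      shiftVar_mul_apply, shiftVar_mul_apply, Derivation.leibniz, hp, hX]
    rfl

theorem shiftVar_mul_shiftVar {i j : σ} (h : i ≠ j) (c : ℂ) :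
    shiftVar i j c * shiftVar i j (-c) = 1 := by
  have : ((aeval (R := ℂ) fun s => if s = i then X i + C c * X j else X s).comp
      (aeval (R := ℂ) fun s => if s = i then X i + C (-c) * X j else X s)) =
      AlgHom.id ℂ (MvPolynomial σ ℂ) := by
    refine MvPolynomial.algHom_ext fun s => ?_
    by_cases hs : s = i
    · subst hs
      simp [h.symm]
    · simp [hs]
  exact congrArg AlgHom.toLinearMap this

theorem dilationFun_mulZ {i s : σ} (h : s ≠ i) (j : σ) (f : ℕ → ℂ) :
    Commute (dilationFun i j f) (mulZ s) :=
  ((shiftVar_mulZ h j (-1)).mul_left (eulerFun_commute_mulZ h f)).mul_left (shiftVar_mulZ h j 1)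

theorem dilationFun_commute_del {i j s : σ} (hi : s ≠ i) (hj : s ≠ j) (f : ℕ → ℂ) :
    Commute (dilationFun i j f) (del s) :=
  ((shiftVar_commute_del hj i (-1)).mul_left (eulerFun_commute_del hi f)).mul_left
    (shiftVar_commute_del hj i 1)

theorem shiftVar_mul_sub {i j : σ} (h : i ≠ j) (c : ℂ) :
    shiftVar i j c * (mulZ i - mulZ j) = (mulZ i + (c - 1) • mulZ j) * shiftVar i j c := by
  rw [mul_sub, shiftVar_mulZ_self, (shiftVar_mulZ h.symm j c).eq, ← sub_mul,
    sub_smul c 1 (mulZ j), one_smul, add_sub_assoc]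

/-- Multiplication by `z_i - z_j` raises the eigenvalue of `z_{ij} ∂_i` by one. In the same way
`∂_i` lowers it by one in `del_mul_dilationFun`. -/
theorem dilationFun_mul_sub {i j : σ} (h : i ≠ j) (f : ℕ → ℂ) :
    dilationFun i j f * (mulZ i - mulZ j) =
      (mulZ i - mulZ j) * dilationFun i j (fun n => f (n + 1)) := by
  have h2 : shiftVar i j (-1) * mulZ i = (mulZ i - mulZ j) * shiftVar i j (-1) := by
    rw [shiftVar_mulZ_self, neg_one_smul ℂ (mulZ j), sub_eq_add_neg]
  rw [dilationFun, mul_assoc, shiftVar_mul_sub h, sub_self, zero_smul, add_zero, mul_assoc,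
    ← mul_assoc (eulerFun i f), eulerFun_mulZ, mul_assoc, ← mul_assoc (shiftVar i j (-1)), h2,
    dilationFun]
  simp only [mul_assoc]

theorem del_mul_dilationFun {i j : σ} (h : i ≠ j) (f : ℕ → ℂ) :
    del i * dilationFun i j f = dilationFun i j (fun n => f (n + 1)) * del i := by
  rw [dilationFun, ← mul_assoc, ← mul_assoc, ← (shiftVar_commute_del h i (-1)).eq,
    mul_assoc (shiftVar i j (-1)), del_mul_eulerFun, dilationFun, mul_assoc _ _ (del i),
    (shiftVar_commute_del h i 1).eq]
  simp only [mul_assoc]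

theorem dilationFun_mul {i j : σ} (h : i ≠ j) (f g : ℕ → ℂ) :
    dilationFun i j f * dilationFun i j g = dilationFun i j (fun n => f n * g n) := by
  have h1 : shiftVar i j 1 * shiftVar i j (-1) = 1 := shiftVar_mul_shiftVar h 1
  rw [dilationFun, dilationFun, dilationFun, ← eulerFun_mul]
  calc _ = shiftVar i j (-1) * eulerFun i f * (shiftVar i j 1 * shiftVar i j (-1)) *
        eulerFun i g * shiftVar i j 1 := by simp only [mul_assoc]
    _ = _ := by rw [h1]; simp only [mul_assoc, mul_one]

theorem dilationFun_add (i j : σ) (f g : ℕ → ℂ) :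
    dilationFun i j (fun n => f n + g n) = dilationFun i j f + dilationFun i j g := by
  simp only [dilationFun, eulerFun_add, mul_add, add_mul]

theorem dilationFun_smul (i j : σ) (c : ℂ) (f : ℕ → ℂ) :
    dilationFun i j (fun n => c * f n) = c • dilationFun i j f := by
  simp only [dilationFun, eulerFun_smul, mul_smul_comm, smul_mul_assoc]

theorem dilationFun_cast {i j : σ} (h : i ≠ j) :
    dilationFun i j (fun n => (n : ℂ)) = (mulZ i - mulZ j) * del i := by
  have h1 := shiftVar_mul_shiftVar h (-1)
  rw [neg_neg] at h1
  have h2 : shiftVar i j (-1) * mulZ i = (mulZ i - mulZ j) * shiftVar i j (-1) := by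
    rw [shiftVar_mulZ_self, neg_one_smul ℂ (mulZ j), sub_eq_add_neg]
  rw [dilationFun, eulerFun_cast, ← mul_assoc, h2, mul_assoc, mul_assoc,
    ← (shiftVar_commute_del h i 1).eq, ← mul_assoc (shiftVar i j (-1)), h1, one_mul]

theorem dilationFun_neg (i j : σ) (f : ℕ → ℂ) :
    dilationFun i j (fun n => -f n) = -dilationFun i j f := by
  have h := dilationFun_smul i j (-1) f
  rw [neg_one_smul ℂ (dilationFun i j f)] at h
  simpa using h

theorem dilationFun_sub (i j : σ) (f g : ℕ → ℂ) :
    dilationFun i j (fun n => f n - g n) = dilationFun i j f - dilationFun i j g := by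
  simp only [sub_eq_add_neg, dilationFun_add, dilationFun_neg]

/-- Split `z_i = (z_i - z_j) + z_j`: the first part shifts `f`, the second commutes with the
dilation. -/
theorem dilationFun_mulZ_self {i j : σ} (h : i ≠ j) (f : ℕ → ℂ) :
    dilationFun i j f * mulZ i = mulZ i * dilationFun i j (fun n => f (n + 1)) +
      mulZ j * dilationFun i j (fun n => f n - f (n + 1)) := by
  have h1 := dilationFun_mul_sub h f
  rw [mul_sub, (dilationFun_mulZ h.symm j f).eq, sub_eq_iff_eq_add] at h1
  rw [h1, dilationFun_sub, sub_mul, mul_sub]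
  abel

theorem dilationFun_monomial_of_eq_zero {i j : σ} (h : i ≠ j) (f : ℕ → ℂ) (e : σ →₀ ℕ)
    (he : e i = 0) : dilationFun i j f (monomial e 1) = f 0 • monomial e 1 := by
  have := dilationFun_eigen i j h f 0 e he
  rwa [pow_zero, one_mul] at this

end Operators

/-! ### Traces of products of matrices that are simultaneously conjugate to triangular ones. -/

section TriangularMonodromy

open Matrix

variable {ι R : Type*} [Ring R]

/-- The lower unitriangular matrix with entry `z`. -/
def lowerUni (z : R) : Matrix (Fin 2) (Fin 2) R := !![1, 0; z, 1]

/-- An upper triangular `2 × 2` matrix. -/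
def upperTri (a c b : R) : Matrix (Fin 2) (Fin 2) R := !![a, c; 0, b]

/-- The upper right entry of the product of the matrices `upperTri (α k) (κ k) (β k)`. -/
def corner (α κ β : ι → R) : List ι → R
  | [] => 0
  | k :: l => α k * corner α κ β l + κ k * (l.map β).prod

theorem prod_upperTri (α κ β : ι → R) (l : List ι) :
    (l.map fun k => upperTri (α k) (κ k) (β k)).prod =
      upperTri (l.map α).prod (corner α κ β l) (l.map β).prod := by
  induction l with
  | nil => simp [upperTri, corner, Matrix.one_fin_two]
  | cons k l ih =>
    rw [List.map_cons, List.prod_cons, ih, upperTri, upperTri, Matrix.mul_fin_two]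
    simp [upperTri, corner]

theorem prod_mul_eq_mul_prod {S : Type*} [Monoid S] {X T : ι → S} {M : S}
    (h : ∀ k, X k * M = M * T k) (l : List ι) :
    (l.map X).prod * M = M * (l.map T).prod := by
  induction l with
  | nil => simp
  | cons k l ih => simp only [List.map_cons, List.prod_cons]; rw [mul_assoc, ih, ← mul_assoc, h,
      mul_assoc]

/-- The inner conjugations cancel. The trace over a noncommutative ring is not invariant under the
remaining one, and the defect is exactly the commutator of `z` with the upper right entry. -/
theorem trace_prod_of_conj {X : ι → Matrix (Fin 2) (Fin 2) R} {α κ β : ι → R} {z : R}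
    (h : ∀ k, X k * lowerUni z = lowerUni z * upperTri (α k) (κ k) (β k)) (l : List ι) :
    (l.map X).prod.trace = (l.map α).prod + (l.map β).prod +
      (z * corner α κ β l - corner α κ β l * z) := by
  have hinv : lowerUni z * lowerUni (-z) = 1 := by
    simp [lowerUni, Matrix.one_fin_two]
  have h1 := prod_mul_eq_mul_prod h l
  rw [prod_upperTri] at h1
  have h2 : (l.map X).prod = lowerUni z *
      upperTri (l.map α).prod (corner α κ β l) (l.map β).prod * lowerUni (-z) := by
    rw [← h1, mul_assoc, hinv, mul_one]
  rw [h2]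
  simp only [lowerUni, upperTri, Matrix.mul_fin_two, Matrix.trace_fin_two_of]
  noncomm_ring

theorem diagonal_commute {n : Type*} [Fintype n] [DecidableEq n] {L : Matrix n n R} {b : R}
    (h : ∀ i j, Commute (L i j) b) : Commute L (diagonal fun _ => b) := by
  ext i j
  rw [mul_diagonal, diagonal_mul]
  exact h i j

theorem commute_list_prod {S : Type*} [Monoid S] {x : S} {f : ι → S} {l : List ι}
    (h : ∀ k ∈ l, Commute x (f k)) : Commute x (l.map f).prod :=
  Commute.list_prod_right _ _ fun y hy => by
    obtain ⟨k, hk, rfl⟩ := List.mem_map.1 hy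
    exact h k hk

theorem prod_diagonal {n : Type*} [Fintype n] [DecidableEq n] (B : ι → R) (l : List ι) :
    (l.map fun k => diagonal fun _ : n => B k).prod = diagonal fun _ : n => (l.map B).prod := by
  induction l with
  | nil => simp
  | cons k l ih => simp [ih]

/-- Regroups a product over sites. Distinctness of the list is essential because `L k` and `B k`
need not commute. -/
theorem prod_mul_of_commute {S : Type*} [Monoid S] {L B : ι → S}
    (h : ∀ j k, j ≠ k → Commute (L j) (B k)) {l : List ι} (hl : l.Nodup) :
    (l.map fun k => L k * B k).prod = (l.map L).prod * (l.map B).prod := by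
  induction l with
  | nil => simp
  | cons k l ih =>
    rw [List.nodup_cons] at hl
    have hc : Commute (B k) (l.map L).prod :=
      commute_list_prod fun j hj => (h j k fun e => hl.1 (e ▸ hj)).symm
    simp only [List.map_cons, List.prod_cons]
    rw [ih hl.2, mul_assoc, ← mul_assoc (B k), hc.eq]
    simp only [mul_assoc]

theorem trace_prod_mul_prod {L : ι → Matrix (Fin 2) (Fin 2) R} {B α κ β : ι → R} {z : R}
    (h : ∀ k, L k * diagonal (fun _ => B k) * lowerUni z =
      lowerUni z * upperTri (α k) (κ k) (β k))
    (hc : ∀ j k, j ≠ k → ∀ a b, Commute (L j a b) (B k)) {l : List ι} (hl : l.Nodup) :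
    (l.map L).prod.trace * (l.map B).prod = (l.map α).prod + (l.map β).prod +
      (z * corner α κ β l - corner α κ β l * z) := by
  rw [← trace_prod_of_conj h, prod_mul_of_commute (B := fun k => diagonal fun _ => B k)
    (fun j k hjk => diagonal_commute (hc j k hjk)) hl, prod_diagonal]
  simp [Matrix.trace_fin_two, mul_diagonal, add_mul]

theorem prod_mul_trace_prod {L : ι → Matrix (Fin 2) (Fin 2) R} {B α κ β : ι → R} {z : R}
    (h : ∀ k, diagonal (fun _ => B k) * L k * lowerUni z =
      lowerUni z * upperTri (α k) (κ k) (β k))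
    (hc : ∀ j k, j ≠ k → ∀ a b, Commute (L j a b) (B k)) {l : List ι} (hl : l.Nodup) :
    (l.map B).prod * (l.map L).prod.trace = (l.map α).prod + (l.map β).prod +
      (z * corner α κ β l - corner α κ β l * z) := by
  rw [← trace_prod_of_conj h, prod_mul_of_commute (L := fun k => diagonal fun _ => B k)
    (fun j k hjk => (diagonal_commute (hc k j hjk.symm)).symm) hl, prod_diagonal]
  simp [Matrix.trace_fin_two, diagonal_mul, mul_add]

theorem prod_smul_list [Algebra ℂ R] (c : ι → ℂ) (B : ι → R)
    (l : List ι) : (l.map fun k => c k • B k).prod = (l.map c).prod • (l.map B).prod := by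
  induction l with
  | nil => simp
  | cons k l ih => simp [ih, smul_smul, mul_comm]

end TriangularMonodromy

/-! ### Local intertwining relations between a Lax matrix and a function of a dilation. -/

section LocalRelations

open Matrix

variable {σ : Type*} [DecidableEq σ]

theorem end_mul_neg {σ : Type*} (A B : Module.End ℂ (MvPolynomial σ ℂ)) : A * -B = -(A * B) :=
  mul_neg A B

theorem end_neg_mul {σ : Type*} (A B : Module.End ℂ (MvPolynomial σ ℂ)) : -A * B = -(A * B) :=
  neg_mul A B

theorem dilationFun_X_mul {i j : σ} (h : i ≠ j) (f : ℕ → ℂ) (p : MvPolynomial σ ℂ) :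
    dilationFun i j f (X i * p) = X i * dilationFun i j (fun n => f (n + 1)) p +
      X j * (dilationFun i j f p - dilationFun i j (fun n => f (n + 1)) p) := by
  have := LinearMap.congr_fun (dilationFun_mulZ_self h f) p
  rwa [dilationFun_sub] at this

theorem dilationFun_X_mul_of_ne {i s : σ} (h : s ≠ i) (j : σ) (f : ℕ → ℂ)
    (p : MvPolynomial σ ℂ) : dilationFun i j f (X s * p) = X s * dilationFun i j f p :=
  LinearMap.congr_fun (dilationFun_mulZ h j f) p

theorem dilationFun_cast_mul {i j : σ} (h : i ≠ j) (f : ℕ → ℂ) (p : MvPolynomial σ ℂ) :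
    dilationFun i j (fun n => n * f n) p = (X i - X j) * pderiv i (dilationFun i j f p) := by
  rw [← dilationFun_mul h (fun n => (n : ℂ)) f, dilationFun_cast h]
  simp [Module.End.mul_apply, sub_mul]

theorem dilationFun_cast_mul' {i j : σ} (h : i ≠ j) (f : ℕ → ℂ) (p : MvPolynomial σ ℂ) :
    dilationFun i j (fun n => n * f n) p =
      (X i - X j) * dilationFun i j (fun n => f (n + 1)) (pderiv i p) := by
  have := LinearMap.congr_fun (del_mul_dilationFun h f) p
  rw [dilationFun_cast_mul h]
  exact congrArg _ this

theorem dilationFun_affine {i j : σ} (a : ℂ) (f : ℕ → ℂ) (p : MvPolynomial σ ℂ) :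
    dilationFun i j (fun n => (a + n) * f n) p =
      C a * dilationFun i j f p + dilationFun i j (fun n => n * f n) p := by
  simp only [add_mul, dilationFun_add, dilationFun_smul, LinearMap.add_apply,
    LinearMap.smul_apply, smul_eq_C_mul]

/-- The recurrence `hf`, read as an operator identity, makes the lower left entry vanish and brings
the upper left one to the form `g`. The second column needs no condition on `f`. -/
theorem lax_mul_dilationFun {i j : σ} (h : i ≠ j) {up um : ℂ} {f g g' : ℕ → ℂ}
    (hf : ∀ n : ℕ, (up - um + n) * f n = (1 - um + n) * f (n + 1))
    (hg : ∀ n, g n = um * (f n - f (n + 1))) (hg' : ∀ n : ℕ, g' n = (um - n) * f n) :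
    lax i up um * diagonal (fun _ => dilationFun i j f) * lowerUni (mulZ i) =
      lowerUni (mulZ j) * upperTri (dilationFun i j g) (-(del i * dilationFun i j f))
        (dilationFun i j g') := by
  have hrec : ∀ p, C (up - um) * dilationFun i j f p +
        (X i - X j) * pderiv i (dilationFun i j f p) =
      C (1 - um) * dilationFun i j (fun n => f (n + 1)) p +
        (X i - X j) * pderiv i (dilationFun i j (fun n => f (n + 1)) p) := fun p => by
    rw [← dilationFun_cast_mul h, ← dilationFun_cast_mul h, ← dilationFun_affine,
      ← dilationFun_affine]
    simp only [hf]
  have eg : ∀ p, dilationFun i j g p =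
      C um * (dilationFun i j f p - dilationFun i j (fun n => f (n + 1)) p) := fun p => by
    rw [funext hg, dilationFun_smul, dilationFun_sub]
    simp [smul_eq_C_mul]
  have eg' : ∀ p, dilationFun i j g' p =
      C um * dilationFun i j f p - (X i - X j) * pderiv i (dilationFun i j f p) := fun p => by
    rw [funext hg', ← dilationFun_cast_mul h]
    simp only [sub_mul, dilationFun_sub, dilationFun_smul, LinearMap.sub_apply,
      LinearMap.smul_apply, smul_eq_C_mul]
  have hd : (diagonal fun _ : Fin 2 => dilationFun i j f) =
      !![dilationFun i j f, 0; 0, dilationFun i j f] := by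
    ext a b; fin_cases a <;> fin_cases b <;> rfl
  rw [hd, lax, lowerUni, lowerUni, upperTri, mul_fin_two, mul_fin_two, mul_fin_two]
  congr 1
  ext a b : 2
  refine LinearMap.ext fun p => ?_
  have hr := hrec p
  simp only [C_sub, C_1] at hr
  fin_cases a <;> fin_cases b <;>
    simp [Module.End.mul_apply, dilationFun_X_mul h, eg, eg', smul_eq_C_mul,
      pderiv_X_of_ne h.symm, pow_two] <;>
    first
    | ring1
    | linear_combination hr
    | linear_combination X i * hr

/-- Counterpart with the Lax matrix on the right; here `hf` is needed only for the lower left entry.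
In `g'` the truncated value `f (0 - 1)` is harmless, being multiplied by zero. -/
theorem dilationFun_mul_lax {i j : σ} (h : i ≠ j) {up um : ℂ} {f g g' : ℕ → ℂ}
    (hf : ∀ n : ℕ, (up + n) * f n = (up - um + n) * f (n + 1))
    (hg : ∀ n : ℕ, g n = (up + n) * f n) (hg' : ∀ n : ℕ, g' n = (um - n) * f n + n * f (n - 1)) :
    diagonal (fun _ => dilationFun i j f) * lax i up um * lowerUni (mulZ j) =
      lowerUni (mulZ i) * upperTri (dilationFun i j g) (-(dilationFun i j f * del i))
        (dilationFun i j g') := by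
  have hrec : ∀ p, C up * dilationFun i j f p +
        (X i - X j) * dilationFun i j (fun n => f (n + 1)) (pderiv i p) =
      C (up - um) * dilationFun i j (fun n => f (n + 1)) p +
        (X i - X j) * dilationFun i j (fun n => f (n + 1 + 1)) (pderiv i p) := fun p => by
    rw [← dilationFun_cast_mul' h, ← dilationFun_cast_mul' h (fun n => f (n + 1)),
      ← dilationFun_affine, ← dilationFun_affine]
    simp only [hf]
  have eg : ∀ p, dilationFun i j g p = C up * dilationFun i j f p +
      (X i - X j) * dilationFun i j (fun n => f (n + 1)) (pderiv i p) := fun p => by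
    rw [funext hg, dilationFun_affine, dilationFun_cast_mul' h]
  have eg' : ∀ p, dilationFun i j g' p = C um * dilationFun i j f p -
      (X i - X j) * dilationFun i j (fun n => f (n + 1)) (pderiv i p) +
      (X i - X j) * dilationFun i j f (pderiv i p) := fun p => by
    -- Moving `∂_i` to the right shifts the index by one and undoes the `n - 1`.
    have h2 := dilationFun_cast_mul' h (fun n => f (n - 1)) p
    simp only [Nat.add_sub_cancel] at h2
    rw [funext hg', ← dilationFun_cast_mul' h, ← h2]
    simp only [sub_mul, dilationFun_sub, dilationFun_smul, dilationFun_add, LinearMap.sub_apply,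
      LinearMap.add_apply, LinearMap.smul_apply, smul_eq_C_mul]
  have hd : (diagonal fun _ : Fin 2 => dilationFun i j f) =
      !![dilationFun i j f, 0; 0, dilationFun i j f] := by
    ext a b; fin_cases a <;> fin_cases b <;> rfl
  rw [hd, lax, lowerUni, lowerUni, upperTri, mul_fin_two, mul_fin_two, mul_fin_two]
  congr 1
  ext a b : 2
  refine LinearMap.ext fun p => ?_
  have hr := hrec p
  simp only [C_sub] at hr
  fin_cases a <;> fin_cases b <;>
    simp [Module.End.mul_apply, dilationFun_X_mul h, dilationFun_X_mul_of_ne h.symm, eg, eg',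
      pderiv_X_of_ne h.symm, pow_two, mul_assoc] <;>
    (try simp only [smul_eq_C_mul, C_sub]) <;>
    first
    | ring1
    | linear_combination hr
    | linear_combination (X j - X i) * hr

end LocalRelations

/-! ### The exchange operators and the triangular relation at one site. -/

section Permutation

open Matrix

variable {N : ℕ}

theorem permOp_apply_mul (k : Fin N) (p q : Extended N) :
    permOp k (p * q) = permOp k p * permOp k q :=
  map_mul (rename _) p q

theorem permOp_mulZ (k : Fin N) (s : Option (Fin N)) :
    permOp k * mulZ s = mulZ (Equiv.swap (some k) none s) * permOp k :=
  LinearMap.ext fun p => by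
    simp only [Module.End.mul_apply, mulZ_apply, permOp_apply_mul]
    simp [permOp]

theorem permOp_del (k : Fin N) (s : Option (Fin N)) :
    permOp k * del s = del (Equiv.swap (some k) none s) * permOp k := by
  refine LinearMap.ext fun p => ?_
  simp only [Module.End.mul_apply, del_apply]
  induction p using MvPolynomial.induction_on with
  | C a => simp [permOp]
  | add p q hp hq => simp only [map_add, hp, hq]
  | mul_X p t hp =>
    have hX : permOp k (pderiv s (X t)) =
        pderiv (Equiv.swap (some k) none s) (permOp k (X t : Extended N)) := by
      by_cases hts : t = s
      · subst hts; simp [permOp]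
      · rw [pderiv_X_of_ne hts]
        simp only [permOp, AlgHom.toLinearMap_apply, map_zero, rename_X]
        rw [pderiv_X_of_ne fun e => hts ((Equiv.swap (some k) none).injective e)]
    rw [Derivation.leibniz, map_add, smul_eq_mul, smul_eq_mul, permOp_apply_mul,
      permOp_apply_mul, permOp_apply_mul, Derivation.leibniz, hp, hX]
    rfl

theorem permOp_mulZ_none (k : Fin N) : permOp k * mulZ none = mulZ (some k) * permOp k := by
  rw [permOp_mulZ, Equiv.swap_apply_right]

theorem permOp_del_none (k : Fin N) : permOp k * del none = del (some k) * permOp k := by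
  rw [permOp_del, Equiv.swap_apply_right]

theorem permOp_commute_mulZ {j k : Fin N} (h : j ≠ k) : Commute (permOp k) (mulZ (some j)) := by
  have := permOp_mulZ k (some j)
  rwa [Equiv.swap_apply_of_ne_of_ne (by simpa using h) (by simp)] at this

theorem permOp_commute_del {j k : Fin N} (h : j ≠ k) : Commute (permOp k) (del (some j)) := by
  have := permOp_del k (some j)
  rwa [Equiv.swap_apply_of_ne_of_ne (by simpa using h) (by simp)] at this

theorem diagonal_permOp_mul_lax (k : Fin N) (up um : ℂ) :
    diagonal (fun _ => permOp k) * lax none up um =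
      lax (some k) up um * diagonal (fun _ => permOp k) := by
  have h1 := permOp_mulZ_none k
  have h2 := permOp_del_none k
  have h3 : permOp k * (mulZ none * del none) = mulZ (some k) * del (some k) * permOp k := by
    rw [← mul_assoc, h1, mul_assoc, h2, mul_assoc]
  have h4 : permOp k * (mulZ none ^ 2 * del none) =
      mulZ (some k) ^ 2 * del (some k) * permOp k := by
    rw [pow_two, mul_assoc, ← mul_assoc, h1, mul_assoc, h3, pow_two]
    simp only [mul_assoc]
  ext a b : 2
  rw [diagonal_mul, mul_diagonal]
  fin_cases a <;> fin_cases b <;> simp [lax, mul_add, add_mul, mul_sub, sub_mul, h1,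
    h3, h4, end_mul_neg, end_neg_mul, h2]

theorem diagonal_permOp_mul_lowerUni (k : Fin N) (s : Option (Fin N)) :
    diagonal (fun _ => permOp k) * lowerUni (mulZ s) =
      lowerUni (mulZ (Equiv.swap (some k) none s)) * diagonal (fun _ => permOp k) := by
  ext a b : 2
  rw [diagonal_mul, mul_diagonal]
  fin_cases a <;> fin_cases b <;> simp [lowerUni, permOp_mulZ]

theorem diagonal_mul_upperTri {R : Type*} [Ring R] (p a c b : R) :
    diagonal (fun _ => p) * upperTri a c b = upperTri (p * a) (p * c) (p * b) := by
  ext i j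
  rw [diagonal_mul]
  fin_cases i <;> fin_cases j <;> simp [upperTri]

theorem diagonal_const_mul {R : Type*} [Ring R] (p q : R) :
    (diagonal fun _ : Fin 2 => p * q) = diagonal (fun _ => p) * diagonal (fun _ => q) := by
  rw [diagonal_mul_diagonal]

/-- The local relation has `M(z_0)` on the right and `M(z_k)` on the left. Passing `P_{k0}` through
turns the latter into `M(z_0)`, so one matrix serves all sites. -/
theorem lax_mul_permOp_mul {k : Fin N} {up um : ℂ} {f g g' : ℕ → ℂ}
    (hf : ∀ n : ℕ, (up - um + n) * f n = (1 - um + n) * f (n + 1))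
    (hg : ∀ n, g n = um * (f n - f (n + 1))) (hg' : ∀ n : ℕ, g' n = (um - n) * f n) :
    lax (some k) up um * diagonal (fun _ => permOp k * dilationFun none (some k) f) *
        lowerUni (mulZ none) =
      lowerUni (mulZ none) * upperTri (permOp k * dilationFun none (some k) g)
        (-(del (some k) * (permOp k * dilationFun none (some k) f)))
        (permOp k * dilationFun none (some k) g') := by
  have h := lax_mul_dilationFun (i := none) (j := some k) (by simp) hf hg hg'
  have h2 := diagonal_permOp_mul_lowerUni k (some k)
  rw [Equiv.swap_apply_left] at h2
  rw [diagonal_const_mul, ← mul_assoc, ← diagonal_permOp_mul_lax, mul_assoc, mul_assoc,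
    ← mul_assoc (lax none up um), h, ← mul_assoc, h2, mul_assoc, diagonal_mul_upperTri, end_mul_neg,
    ← mul_assoc (permOp k) (del none), permOp_del_none, mul_assoc]

theorem permOp_mul_mul_lax {k : Fin N} {up um : ℂ} {f g g' : ℕ → ℂ}
    (hf : ∀ n : ℕ, (up + n) * f n = (up - um + n) * f (n + 1))
    (hg : ∀ n : ℕ, g n = (up + n) * f n) (hg' : ∀ n : ℕ, g' n = (um - n) * f n + n * f (n - 1)) :
    diagonal (fun _ => permOp k * dilationFun (some k) none f) * lax (some k) up um *
        lowerUni (mulZ none) =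
      lowerUni (mulZ none) * upperTri (permOp k * dilationFun (some k) none g)
        (-(permOp k * dilationFun (some k) none f * del (some k)))
        (permOp k * dilationFun (some k) none g') := by
  have h := dilationFun_mul_lax (i := some k) (j := none) (by simp) hf hg hg'
  have h2 := diagonal_permOp_mul_lowerUni k (some k)
  rw [Equiv.swap_apply_left] at h2
  rw [diagonal_const_mul, mul_assoc, mul_assoc, ← mul_assoc _ (lax (some k) up um), h, ← mul_assoc,
    h2, mul_assoc, diagonal_mul_upperTri, end_mul_neg]
  simp only [mul_assoc]

theorem lax_commute {σ : Type*} {s : σ} {A : Module.End ℂ (MvPolynomial σ ℂ)}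
    (h1 : Commute (mulZ s) A) (h2 : Commute (del s) A) (up um : ℂ) (a b : Fin 2) :
    Commute (lax s up um a b) A := by
  have h3 := h1.mul_left h2
  have h4 := (h1.pow_left 2).mul_left h2
  have h5 : ∀ c : ℂ, Commute (c • (1 : Module.End ℂ (MvPolynomial σ ℂ))) A := fun c =>
    (Commute.one_left A).smul_left c
  have h6 : ∀ c : ℂ, Commute (c • mulZ s) A := fun c => h1.smul_left c
  fin_cases a <;> fin_cases b
  · exact (h5 up).add_left h3
  · exact h2.neg_left
  · exact h4.add_left (h6 _)
  · exact (h5 um).sub_left h3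

theorem lax_commute_permOp_mul_minus {j k : Fin N} (h : j ≠ k) (f : ℕ → ℂ) (up um : ℂ)
    (a b : Fin 2) :
    Commute (lax (some j) up um a b) (permOp k * dilationFun (some k) none f) := by
  have h' : some j ≠ some k := by simpa using h
  refine lax_commute ?_ ?_ up um a b
  · exact ((permOp_commute_mulZ h).mul_left (dilationFun_mulZ h' _ f)).symm
  · exact ((permOp_commute_del h).mul_left (dilationFun_commute_del h' (by simp) f)).symm

theorem lax_commute_permOp_mul_plus {j k : Fin N} (h : j ≠ k) (f : ℕ → ℂ) (up um : ℂ)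
    (a b : Fin 2) :
    Commute (lax (some j) up um a b) (permOp k * dilationFun none (some k) f) := by
  have h' : some j ≠ some k := by simpa using h
  refine lax_commute ?_ ?_ up um a b
  · exact ((permOp_commute_mulZ h).mul_left (dilationFun_mulZ (by simp) _ f)).symm
  · exact ((permOp_commute_del h).mul_left (dilationFun_commute_del (by simp) h' f)).symm

end Permutation

/-! ### Contiguous relations for quotients of Pochhammer symbols. -/

section Pochhammer

theorem ascPochhammer_eval_ne_zero {b : ℂ} (hb : ∀ n : ℕ, b ≠ -n) (n : ℕ) :
    (ascPochhammer ℂ n).eval b ≠ 0 := by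
  induction n with
  | zero => simp
  | succ n ih =>
    rw [ascPochhammer_succ_eval]
    exact mul_ne_zero ih fun h => hb n (by linear_combination h)

theorem ascPochhammer_eval_add_one (b : ℂ) (n : ℕ) :
    b * (ascPochhammer ℂ n).eval (b + 1) = (ascPochhammer ℂ n).eval b * (b + n) := by
  rw [← ascPochhammer_succ_eval, ascPochhammer_succ_left]
  simp

theorem pochRatio_succ (a c : ℂ) (n : ℕ) :
    pochRatio a c (n + 1) = pochRatio a c n * ((a + n) / (c + n)) := by
  simp only [pochRatio, ascPochhammer_succ_eval, mul_div_mul_comm]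

theorem pochRatio_rec (a : ℂ) {c : ℂ} (hc : ∀ n : ℕ, c ≠ -n) (n : ℕ) :
    (a + n) * pochRatio a c n = (c + n) * pochRatio a c (n + 1) := by
  have : c + n ≠ 0 := fun h => hc n (by linear_combination h)
  rw [pochRatio_succ]
  field_simp

theorem pochRatio_add_one_left (a c : ℂ) (n : ℕ) :
    a * pochRatio (a + 1) c n = (a + n) * pochRatio a c n := by
  rw [pochRatio, pochRatio, ← mul_div_assoc, ascPochhammer_eval_add_one, ← mul_div_assoc, mul_comm]

/-- Identifies the lower diagonal entry for `R⁻` with a multiple of `R⁻` at `u - 1`. The other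
relations here play this role for the remaining diagonal entries. -/
theorem pochRatio_sub_one_left {a um : ℂ} (hc : ∀ n : ℕ, a - um ≠ -n) (n : ℕ) :
    (um - n) * pochRatio a (a - um) n + n * pochRatio a (a - um) (n - 1) =
      um * pochRatio (a - 1) (a - um) n := by
  cases n with
  | zero => simp [pochRatio]
  | succ n =>
    have h1 : a - um + n ≠ 0 := fun h => hc n (by linear_combination h)
    have h2 : pochRatio (a - 1) (a - um) (n + 1) =
        pochRatio a (a - um) n * ((a - 1) / (a - um + n)) := by
      have := ascPochhammer_eval_add_one (a - 1) n
      rw [sub_add_cancel] at this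
      simp only [pochRatio, ascPochhammer_succ_eval, ← this]
      rw [mul_comm (a - 1), mul_div_mul_comm]
    rw [h2, pochRatio_succ, Nat.add_sub_cancel]
    push_cast
    field_simp
    ring

theorem pochRatio_add_one_right {b : ℂ} (hb : ∀ n : ℕ, b ≠ -n) (c : ℂ) (n : ℕ) :
    pochRatio c b n - pochRatio c b (n + 1) = (b - c) / b * pochRatio c (b + 1) n := by
  have h0 : b ≠ 0 := by simpa using hb 0
  have h1 : b + n ≠ 0 := fun h => hb n (by linear_combination h)
  have h2 := ascPochhammer_eval_ne_zero hb n
  have h3 : (ascPochhammer ℂ n).eval (b + 1) = (ascPochhammer ℂ n).eval b * (b + n) / b := by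
    rw [← ascPochhammer_eval_add_one]
    field_simp
  rw [pochRatio_succ, pochRatio, pochRatio, h3]
  field_simp
  ring

theorem pochRatio_sub_one_right {b : ℂ} (hb : ∀ n : ℕ, b - 1 ≠ -n) (c : ℂ) (n : ℕ) :
    (b - 1 + n) * pochRatio c b n = (b - 1) * pochRatio c (b - 1) n := by
  have h1 : b - 1 + n ≠ 0 := fun h => hb n (by linear_combination h)
  have h0 : b - 1 ≠ 0 := by simpa using hb 0
  have h2 := ascPochhammer_eval_ne_zero hb n
  have h3 : (ascPochhammer ℂ n).eval b =
      (ascPochhammer ℂ n).eval (b - 1) * (b - 1 + n) / (b - 1) := by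
    rw [← ascPochhammer_eval_add_one, sub_add_cancel]
    field_simp
  rw [pochRatio, pochRatio, h3]
  field_simp

end Pochhammer

/-! ### Coefficients in the auxiliary variable and their compatibility with the transfer matrix. -/

section Trace

variable {N : ℕ}

/-- The coefficient of `z_0^m`, in the form in which it enters `traceTerm`. -/
noncomputable def auxCoeff (m : ℕ) : Extended N →ₗ[ℂ] MvPolynomial (Fin N) ℂ :=
  (1 / (m.factorial : ℂ)) • (evalZero ∘ₗ (del none ^ m))

/-- The map `Ψ ↦ z_0^m Ψ`. -/
noncomputable def auxMul (m : ℕ) : MvPolynomial (Fin N) ℂ →ₗ[ℂ] Extended N :=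
  LinearMap.mulLeft ℂ (X none ^ m) ∘ₗ (rename (R := ℂ) some).toLinearMap

theorem auxMul_apply (m : ℕ) (p : MvPolynomial (Fin N) ℂ) :
    auxMul m p = X none ^ m * rename some p := rfl

theorem traceTerm_eq (A : Module.End ℂ (Extended N)) (m : ℕ) (p : MvPolynomial (Fin N) ℂ) :
    traceTerm A m p = auxCoeff m (A (auxMul m p)) := rfl

theorem coeff_del_pow {σ : Type*} (i : σ) (m : ℕ) (F : MvPolynomial σ ℂ) (e : σ →₀ ℕ) :
    coeff e ((del i ^ m) F) =
      ((e i + m).descFactorial m : ℂ) * coeff (e + Finsupp.single i m) F := by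
  induction m generalizing F with
  | zero => simp
  | succ m ih =>
    rw [pow_succ, Module.End.mul_apply, ih, del_apply, coeff_pderiv, add_assoc,
      ← Finsupp.single_add, ← add_assoc, Nat.succ_descFactorial_succ]
    simp only [Finsupp.add_apply, Finsupp.single_eq_same]
    push_cast
    ring

theorem evalZero_monomial (e : Option (Fin N) →₀ ℕ) :
    evalZero (monomial e 1) = if e none = 0 then monomial e.some 1 else 0 := by
  have h : evalZero (monomial e 1) =
      (0 : MvPolynomial (Fin N) ℂ) ^ e none * monomial e.some 1 := by
    simp only [evalZero, AlgHom.toLinearMap_apply, aeval_monomial, map_one, one_mul]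
    rw [Finsupp.prod_option_index _ _ (by simp) (by intros; rw [pow_add]), monomial_eq]
    simp
  rw [h]
  split_ifs with h0 <;> simp [h0]

theorem optionElim_eq_iff (d : Fin N →₀ ℕ) (m : ℕ) (e : Option (Fin N) →₀ ℕ) :
    d.optionElim m = e ↔ m = e none ∧ d = e.some := by
  constructor
  · rintro rfl; simp
  · rintro ⟨rfl, rfl⟩; simp

theorem coeff_evalZero (F : Extended N) (d : Fin N →₀ ℕ) :
    coeff d (evalZero F) = coeff (d.optionElim 0) F := by
  have : (lcoeff ℂ d) ∘ₗ evalZero = lcoeff ℂ (d.optionElim 0) := by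
    refine hom_ext_monomial fun e => ?_
    simp only [LinearMap.comp_apply, evalZero_monomial, lcoeff_apply, coeff_monomial]
    by_cases h : e none = 0
    · simp [h, coeff_monomial, eq_comm (b := d.optionElim 0), optionElim_eq_iff,
        eq_comm (a := d)]
    · simp [h, eq_comm (b := d.optionElim 0), optionElim_eq_iff, Ne.symm h]
  exact LinearMap.congr_fun this F

theorem coeff_auxCoeff (m : ℕ) (F : Extended N) (d : Fin N →₀ ℕ) :
    coeff d (auxCoeff m F) = coeff (d.optionElim m) F := by
  have h : d.optionElim 0 + Finsupp.single none m = d.optionElim m := by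
    ext s; cases s <;> simp
  simp only [auxCoeff, LinearMap.smul_apply, LinearMap.comp_apply, coeff_smul, coeff_evalZero,
    coeff_del_pow, h]
  simp only [Finsupp.optionElim_apply_none, zero_add, Nat.descFactorial_self, smul_eq_mul]
  have : (m.factorial : ℂ) ≠ 0 := by exact_mod_cast m.factorial_ne_zero
  field_simp

theorem auxCoeff_mulZ (m : ℕ) (k : Fin N) (F : Extended N) :
    auxCoeff m (mulZ (some k) F) = mulZ k (auxCoeff m F) := by
  classical
  ext d
  rw [coeff_auxCoeff, mulZ_apply, mulZ_apply, coeff_X_mul', coeff_X_mul', coeff_auxCoeff]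
  have h : d.optionElim m - Finsupp.single (some k) 1 = (d - Finsupp.single k 1).optionElim m := by
    ext s; cases s <;> simp [Finsupp.single_apply]
  simp [h]

theorem auxCoeff_del (m : ℕ) (k : Fin N) (F : Extended N) :
    auxCoeff m (del (some k) F) = del k (auxCoeff m F) := by
  ext d
  rw [coeff_auxCoeff, del_apply, del_apply, coeff_pderiv, coeff_pderiv, coeff_auxCoeff]
  have h : d.optionElim m + Finsupp.single (some k) 1 = (d + Finsupp.single k 1).optionElim m := by
    ext s; cases s <;> simp [Finsupp.single_apply]
  simp [h]

theorem auxCoeff_zero_mulZ_none (F : Extended N) : auxCoeff 0 (mulZ none F) = 0 := by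
  classical
  ext d
  rw [coeff_auxCoeff, mulZ_apply, coeff_X_mul']
  simp

theorem auxCoeff_succ_mulZ_none (m : ℕ) (F : Extended N) :
    auxCoeff (m + 1) (mulZ none F) = auxCoeff m F := by
  ext d
  have h : d.optionElim (m + 1) = Finsupp.single none 1 + d.optionElim m := by
    ext s; cases s <;> simp [add_comm]
  rw [coeff_auxCoeff, mulZ_apply, h, coeff_X_mul, coeff_auxCoeff]

theorem mulZ_none_auxMul (m : ℕ) (p : MvPolynomial (Fin N) ℂ) :
    mulZ none (auxMul m p) = auxMul (m + 1) p := by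
  rw [mulZ_apply, auxMul_apply, auxMul_apply, pow_succ', mul_assoc]

theorem auxMul_mulZ (m : ℕ) (k : Fin N) (p : MvPolynomial (Fin N) ℂ) :
    auxMul m (mulZ k p) = mulZ (some k) (auxMul m p) := by
  simp only [auxMul_apply, mulZ_apply, map_mul, rename_X]
  ring

theorem auxMul_monomial (m : ℕ) (d : Fin N →₀ ℕ) :
    auxMul m (monomial d (1 : ℂ)) = monomial (d.optionElim m) 1 := by
  have h : Finsupp.single none m + Finsupp.mapDomain some d = d.optionElim m := by
    ext s
    cases s with
    | none => simp [Finsupp.mapDomain_of_notMem_range]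
    | some k => simp [Finsupp.mapDomain_apply (Option.some_injective _)]
  rw [auxMul_apply, rename_monomial, X_pow_eq_monomial, monomial_mul, one_mul, h]

theorem auxMul_del (m : ℕ) (k : Fin N) (p : MvPolynomial (Fin N) ℂ) :
    auxMul m (del k p) = del (some k) (auxMul m p) := by
  have : auxMul m ∘ₗ del k = del (some k) ∘ₗ auxMul m := by
    refine hom_ext_monomial fun d => ?_
    have h : (d.optionElim m : Option (Fin N) →₀ ℕ) - Finsupp.single (some k) 1 =
        (d - Finsupp.single k 1).optionElim m := by
      ext s; cases s <;> simp [Finsupp.single_apply]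
    rw [LinearMap.comp_apply, LinearMap.comp_apply, del_monomial, map_smul, auxMul_monomial,
      auxMul_monomial, del_monomial, h, Finsupp.optionElim_apply_some]
  exact LinearMap.congr_fun this p

/-- Lax entries are polynomials in `z_k` and `∂_k`, so intertwining these two suffices. Used for
`auxCoeff` and `auxMul`, it moves the transfer matrix into or out of the trace over `V_0`. -/
theorem map_list_prod_lax {ι σ τ : Type*} {J : MvPolynomial σ ℂ →ₗ[ℂ] MvPolynomial τ ℂ}
    {a : ι → σ} {b : ι → τ} (hZ : ∀ k p, J (mulZ (a k) p) = mulZ (b k) (J p))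
    (hD : ∀ k p, J (del (a k) p) = del (b k) (J p)) (up um : ι → ℂ) (l : List ι) (i j : Fin 2)
    (p : MvPolynomial σ ℂ) :
    J ((l.map fun k => lax (a k) (up k) (um k)).prod i j p) =
      (l.map fun k => lax (b k) (up k) (um k)).prod i j (J p) := by
  have hL : ∀ k i j p, J (lax (a k) (up k) (um k) i j p) =
      lax (b k) (up k) (um k) i j (J p) := by
    intro k i j p
    fin_cases i <;> fin_cases j <;>
      simp [lax, Module.End.mul_apply, -mulZ_apply, -del_apply, hZ, hD, pow_two]
  induction l generalizing i j p with
  | nil =>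
    by_cases h : i = j
    · subst h; simp
    · simp [h]
  | cons k l ih =>
    simp only [List.map_cons, List.prod_cons, Matrix.mul_apply, LinearMap.sum_apply,
      Module.End.mul_apply, map_sum, hL, ih]

theorem map_trace_prod_lax {ι σ τ : Type*} {J : MvPolynomial σ ℂ →ₗ[ℂ] MvPolynomial τ ℂ}
    {a : ι → σ} {b : ι → τ} (hZ : ∀ k p, J (mulZ (a k) p) = mulZ (b k) (J p))
    (hD : ∀ k p, J (del (a k) p) = del (b k) (J p)) (up um : ι → ℂ) (l : List ι)
    (p : MvPolynomial σ ℂ) :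
    J ((l.map fun k => lax (a k) (up k) (um k)).prod.trace p) =
      (l.map fun k => lax (b k) (up k) (um k)).prod.trace (J p) := by
  simp only [Matrix.trace_fin_two, LinearMap.add_apply, map_add, map_list_prod_lax hZ hD]

/-- The transfer matrix as an operator on `ℂ[z_0, …, z_N]`. -/
noncomputable def transferMatrixExt (l δ : Fin N → ℂ) (u : ℂ) : Module.End ℂ (Extended N) :=
  ((List.finRange N).map fun k => lax (some k) (u + δ k + l k) (u + δ k - l k)).prod.trace

theorem auxCoeff_transferMatrixExt (l δ : Fin N → ℂ) (u : ℂ) (m : ℕ) (F : Extended N) :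
    auxCoeff m (transferMatrixExt l δ u F) = transferMatrix l δ u (auxCoeff m F) := by
  rw [transferMatrix, transferMatrixExt, List.ofFn_eq_map]
  exact map_trace_prod_lax (a := some) (b := id) (auxCoeff_mulZ m) (auxCoeff_del m) _ _ _ _

theorem auxMul_transferMatrix (l δ : Fin N → ℂ) (u : ℂ) (m : ℕ) (p : MvPolynomial (Fin N) ℂ) :
    auxMul m (transferMatrix l δ u p) = transferMatrixExt l δ u (auxMul m p) := by
  rw [transferMatrix, transferMatrixExt, List.ofFn_eq_map]
  exact map_trace_prod_lax (a := id) (b := some) (auxMul_mulZ m) (auxMul_del m) _ _ _ _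

end Trace

/-! ### Coefficientwise convergence and the trace of a commutator with `z_0`. -/

section Convergence

open Filter Topology

/-- Convergence of a series of polynomials, coefficient by coefficient. -/
def CoeffHasSum {σ : Type*} (f : ℕ → MvPolynomial σ ℂ) (p : MvPolynomial σ ℂ) : Prop :=
  ∀ d, HasSum (fun m => coeff d (f m)) (coeff d p)

variable {σ : Type*} {f g : ℕ → MvPolynomial σ ℂ} {p q : MvPolynomial σ ℂ}

theorem CoeffHasSum.add (hf : CoeffHasSum f p) (hg : CoeffHasSum g q) :
    CoeffHasSum (fun m => f m + g m) (p + q) := fun d => by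
  simpa using (hf d).add (hg d)

theorem CoeffHasSum.sub (hf : CoeffHasSum f p) (hg : CoeffHasSum g q) :
    CoeffHasSum (fun m => f m - g m) (p - q) := fun d => by
  simpa using (hf d).sub (hg d)

theorem CoeffHasSum.smul (c : ℂ) (hf : CoeffHasSum f p) :
    CoeffHasSum (fun m => c • f m) (c • p) := fun d => by
  simpa using (hf d).mul_left c

theorem CoeffHasSum.zero : CoeffHasSum (fun _ : ℕ => (0 : MvPolynomial σ ℂ)) 0 := fun d => by
  simp [hasSum_zero]

theorem CoeffHasSum.mulZ (i : σ) (hf : CoeffHasSum f p) :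
    CoeffHasSum (fun m => SpinChain.mulZ i (f m)) (SpinChain.mulZ i p) := fun d => by
  classical
  simp only [mulZ_apply, coeff_X_mul']
  split_ifs
  · exact hf _
  · exact hasSum_zero

theorem CoeffHasSum.del (i : σ) (hf : CoeffHasSum f p) :
    CoeffHasSum (fun m => SpinChain.del i (f m)) (SpinChain.del i p) := fun d => by
  simp only [del_apply, coeff_pderiv]
  exact (hf _).mul_right _

/-- A coefficient of the image under `z_k` or `∂_k` is a multiple of one coefficient of the
argument, so these operators respect coefficientwise convergence. -/
theorem CoeffHasSum.list_prod_lax {ι : Type*} (a : ι → σ) (up um : ι → ℂ) (l : List ι)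
    (hf : CoeffHasSum f p) (i j : Fin 2) :
    CoeffHasSum (fun m => (l.map fun k => lax (a k) (up k) (um k)).prod i j (f m))
      ((l.map fun k => lax (a k) (up k) (um k)).prod i j p) := by
  have hL : ∀ k i j {f : ℕ → MvPolynomial σ ℂ} {p}, CoeffHasSum f p →
      CoeffHasSum (fun m => lax (a k) (up k) (um k) i j (f m))
        (lax (a k) (up k) (um k) i j p) := by
    intro k i j f p hf
    have hD := hf.del (a k)
    have hZD := hD.mulZ (a k)
    fin_cases i <;> fin_cases j
    · exact (hf.smul (up k)).add hZD
    · convert (CoeffHasSum.zero (σ := σ)).sub hD using 1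
      · funext m
        rw [zero_sub]
        rfl
      · rw [zero_sub]
        rfl
    · exact (hZD.mulZ (a k)).add ((hf.mulZ (a k)).smul _)
    · exact (hf.smul (um k)).sub hZD
  induction l generalizing i j with
  | nil =>
    by_cases h : i = j
    · subst h; simpa using hf
    · simpa [h] using CoeffHasSum.zero
  | cons k l ih =>
    simp only [List.map_cons, List.prod_cons, Matrix.mul_apply, Fin.sum_univ_two,
      LinearMap.add_apply, Module.End.mul_apply]
    exact (hL k i 0 (ih 0 j)).add (hL k i 1 (ih 1 j))

variable {N : ℕ}

theorem CoeffHasSum.transferMatrix {f : ℕ → MvPolynomial (Fin N) ℂ} {p : MvPolynomial (Fin N) ℂ}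
    (hf : CoeffHasSum f p) (l δ : Fin N → ℂ) (u : ℂ) :
    CoeffHasSum (fun m => SpinChain.transferMatrix l δ u (f m))
      (SpinChain.transferMatrix l δ u p) := by
  simp only [SpinChain.transferMatrix, List.ofFn_eq_map, Matrix.trace_fin_two, LinearMap.add_apply]
  exact (hf.list_prod_lax id _ _ _ 0 0).add (hf.list_prod_lax id _ _ _ 1 1)

/-- Telescoping: the `z_0^{m+1}` coefficient of `z_0 F` is the `z_0^m` coefficient of `F`, so the
first half of each term cancels the second half of the preceding one. -/
theorem sum_traceTerm_commutator (K : Module.End ℂ (Extended N)) (p : MvPolynomial (Fin N) ℂ)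
    (M : ℕ) :
    ∑ m ∈ Finset.range (M + 1), traceTerm (mulZ none * K - K * mulZ none) m p =
      -auxCoeff M (K (auxMul (M + 1) p)) := by
  have h : ∀ m, traceTerm (mulZ none * K - K * mulZ none) m p =
      auxCoeff m (mulZ none (K (auxMul m p))) - auxCoeff m (K (auxMul (m + 1) p)) := fun m => by
    rw [traceTerm_eq, LinearMap.sub_apply, map_sub, Module.End.mul_apply, Module.End.mul_apply,
      mulZ_none_auxMul]
  induction M with
  | zero => simp only [zero_add, Finset.sum_range_one, h, auxCoeff_zero_mulZ_none, zero_sub]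
  | succ M ih =>
    rw [Finset.sum_range_succ, ih, h, auxCoeff_succ_mulZ_none]
    abel

/-- The trace of a commutator with `z_0` vanishes if the boundary terms tend to zero. -/
theorem CoeffHasSum.eq_zero_of_commutator {K : Module.End ℂ (Extended N)}
    {p q : MvPolynomial (Fin N) ℂ}
    (h : CoeffHasSum (fun m => traceTerm (SpinChain.mulZ none * K - K * SpinChain.mulZ none) m p) q)
    (hK : ∀ d, Tendsto (fun m => coeff (Finsupp.optionElim m d) (K (auxMul (m + 1) p))) atTop
      (𝓝 0)) : q = 0 := by
  ext d
  have h1 := ((h d).tendsto_sum_nat.comp (tendsto_add_atTop_nat 1))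
  have h2 : ∀ m, ((fun n => ∑ i ∈ Finset.range n, coeff d
      (traceTerm (SpinChain.mulZ none * K - K * SpinChain.mulZ none) i p)) ∘ fun a => a + 1) m =
      -coeff (d.optionElim m) (K (auxMul (m + 1) p)) := fun m => by
    rw [Function.comp_apply, ← coeff_sum, sum_traceTerm_commutator, coeff_neg, coeff_auxCoeff]
  rw [funext h2] at h1
  simpa using tendsto_nhds_unique h1 (hK d).neg

theorem transferMatrix_mul_trace {l δ : Fin N → ℂ} {u : ℂ} {A A₁ A₂ K : Module.End ℂ (Extended N)}
    {Q Q₁ Q₂ : Module.End ℂ (MvPolynomial (Fin N) ℂ)} {c₁ c₂ : ℂ}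
    (hA : transferMatrixExt l δ u * A = c₁ • A₁ + c₂ • A₂ + (mulZ none * K - K * mulZ none))
    (hQ : HasPartialTrace A Q) (hQ₁ : HasPartialTrace A₁ Q₁) (hQ₂ : HasPartialTrace A₂ Q₂)
    (hK : ∀ p d, Tendsto (fun m => coeff (Finsupp.optionElim m d) (K (auxMul (m + 1) p))) atTop
      (𝓝 0)) :
    transferMatrix l δ u * Q = c₁ • Q₁ + c₂ • Q₂ := by
  refine LinearMap.ext fun p => ?_
  have h1 := ((CoeffHasSum.transferMatrix (hQ p) l δ u).sub (CoeffHasSum.smul c₁ (hQ₁ p))).sub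
    (CoeffHasSum.smul c₂ (hQ₂ p))
  rw [← sub_eq_zero, Module.End.mul_apply, LinearMap.add_apply, LinearMap.smul_apply,
    LinearMap.smul_apply, ← sub_sub]
  refine CoeffHasSum.eq_zero_of_commutator (K := K) (p := p) ?_ (hK p)
  convert h1 using 2 with m
  rw [traceTerm_eq, traceTerm_eq, traceTerm_eq, traceTerm_eq, ← auxCoeff_transferMatrixExt,
    ← Module.End.mul_apply, hA]
  simp only [LinearMap.add_apply, LinearMap.smul_apply, map_add, map_smul]
  abel

theorem trace_mul_transferMatrix {l δ : Fin N → ℂ} {u : ℂ} {A A₁ A₂ K : Module.End ℂ (Extended N)}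
    {Q Q₁ Q₂ : Module.End ℂ (MvPolynomial (Fin N) ℂ)} {c₁ c₂ : ℂ}
    (hA : A * transferMatrixExt l δ u = c₁ • A₁ + c₂ • A₂ + (mulZ none * K - K * mulZ none))
    (hQ : HasPartialTrace A Q) (hQ₁ : HasPartialTrace A₁ Q₁) (hQ₂ : HasPartialTrace A₂ Q₂)
    (hK : ∀ p d, Tendsto (fun m => coeff (Finsupp.optionElim m d) (K (auxMul (m + 1) p))) atTop
      (𝓝 0)) :
    Q * transferMatrix l δ u = c₁ • Q₁ + c₂ • Q₂ := by
  refine LinearMap.ext fun p => ?_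
  have h1 := ((show CoeffHasSum _ _ from hQ (transferMatrix l δ u p)).sub
    (CoeffHasSum.smul c₁ (hQ₁ p))).sub (CoeffHasSum.smul c₂ (hQ₂ p))
  rw [← sub_eq_zero, Module.End.mul_apply, LinearMap.add_apply, LinearMap.smul_apply,
    LinearMap.smul_apply, ← sub_sub]
  refine CoeffHasSum.eq_zero_of_commutator (K := K) (p := p) ?_ (hK p)
  convert h1 using 2 with m
  rw [traceTerm_eq, traceTerm_eq, traceTerm_eq, traceTerm_eq, auxMul_transferMatrix,
    ← Module.End.mul_apply A, hA]
  simp only [LinearMap.add_apply, LinearMap.smul_apply, map_add, map_smul]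
  abel

/-- The sums on monomials extend linearly to an operator, and uniqueness of limits identifies it
with the chosen `partialTrace`. -/
theorem hasPartialTrace_of_monomial {A : Module.End ℂ (Extended N)}
    (h : ∀ d, ∃ q, CoeffHasSum (fun m => traceTerm A m (monomial d 1)) q) :
    HasPartialTrace A (partialTrace A) := by
  choose q hq using h
  have hT : HasPartialTrace A ((basisMonomials (Fin N) ℂ).constr ℂ q) := by
    intro p
    change CoeffHasSum (fun m => auxCoeff m (A (auxMul m p))) _
    induction p using MvPolynomial.induction_on' with
    | monomial d c =>
      have h1 : monomial d c = c • monomial d (1 : ℂ) := by rw [smul_monomial, smul_eq_mul, mul_one]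
      have h2 : (basisMonomials (Fin N) ℂ).constr ℂ q (monomial d 1) = q d := by
        simpa using (basisMonomials (Fin N) ℂ).constr_basis ℂ q d
      rw [h1]
      simp only [map_smul, h2]
      exact (hq d).smul c
    | add p p' hp hp' =>
      simp only [map_add]
      exact hp.add hp'
  rwa [hT.partialTrace_eq]

end Convergence

/-! ### Operators that leave a function of the exponents unchanged. -/

section Exponents

variable {τ : Type*}

/-- All exponents `e` occurring in `F` have `w e ∈ S`. -/
def ExpIn (w : (τ →₀ ℕ) → ℕ) (S : Set ℕ) (F : MvPolynomial τ ℂ) : Prop :=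
  ∀ e, coeff e F ≠ 0 → w e ∈ S

/-- The operator `A` does not change the function `w` of the exponents. -/
def Preserves (w : (τ →₀ ℕ) → ℕ) (A : Module.End ℂ (MvPolynomial τ ℂ)) : Prop :=
  ∀ e e', coeff e' (A (monomial e 1)) ≠ 0 → w e' = w e

theorem coeff_apply_eq_sum (A : Module.End ℂ (MvPolynomial τ ℂ)) (F : MvPolynomial τ ℂ)
    (e' : τ →₀ ℕ) :
    coeff e' (A F) = ∑ e ∈ F.support, coeff e F * coeff e' (A (monomial e 1)) := by
  conv_lhs => rw [← F.support_sum_monomial_coeff, map_sum, coeff_sum]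
  refine Finset.sum_congr rfl fun e _ => ?_
  have h1 : monomial e (coeff e F) = coeff e F • monomial e (1 : ℂ) := by
    rw [smul_monomial, smul_eq_mul, mul_one]
  rw [h1, map_smul, coeff_smul, smul_eq_mul]

theorem exists_of_coeff_apply_ne_zero {A : Module.End ℂ (MvPolynomial τ ℂ)}
    {F : MvPolynomial τ ℂ} {e' : τ →₀ ℕ} (h : coeff e' (A F) ≠ 0) :
    ∃ e, coeff e F ≠ 0 ∧ coeff e' (A (monomial e 1)) ≠ 0 := by
  rw [coeff_apply_eq_sum] at h
  obtain ⟨e, -, h⟩ := Finset.exists_ne_zero_of_sum_ne_zero h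
  exact ⟨e, left_ne_zero_of_mul h, right_ne_zero_of_mul h⟩

variable {w : (τ →₀ ℕ) → ℕ} {S : Set ℕ} {A B : Module.End ℂ (MvPolynomial τ ℂ)}

theorem Preserves.expIn (hA : Preserves w A) {F : MvPolynomial τ ℂ} (hF : ExpIn w S F) :
    ExpIn w S (A F) := fun e' h => by
  obtain ⟨e, h1, h2⟩ := exists_of_coeff_apply_ne_zero h
  rw [hA e e' h2]
  exact hF e h1

theorem expIn_monomial (e : τ →₀ ℕ) : ExpIn w {w e} (monomial e 1) := fun e' h => by
  classical
  rw [coeff_monomial] at h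
  split_ifs at h with h1
  · rw [h1]; rfl
  · exact absurd rfl h

theorem Preserves.mul (hA : Preserves w A) (hB : Preserves w B) : Preserves w (A * B) :=
  fun e => hA.expIn (hB.expIn (expIn_monomial e))

theorem Preserves.one : Preserves w (1 : Module.End ℂ (MvPolynomial τ ℂ)) := fun e =>
  expIn_monomial e

theorem Preserves.add (hA : Preserves w A) (hB : Preserves w B) : Preserves w (A + B) :=
  fun e e' h => by
    rw [LinearMap.add_apply, coeff_add] at h
    by_cases h1 : coeff e' (A (monomial e 1)) = 0
    · exact hB e e' (by simpa [h1] using h)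
    · exact hA e e' h1

theorem Preserves.neg (hA : Preserves w A) : Preserves w (-A) := fun e e' h =>
  hA e e' (by simpa using h)

theorem Preserves.smul (c : ℂ) (hA : Preserves w A) : Preserves w (c • A) := fun e e' h =>
  hA e e' (by
    rw [LinearMap.smul_apply, coeff_smul] at h
    exact right_ne_zero_of_mul h)

theorem Preserves.list_prod {ι : Type*} {f : ι → Module.End ℂ (MvPolynomial τ ℂ)} {l : List ι}
    (h : ∀ k ∈ l, Preserves w (f k)) : Preserves w (l.map f).prod := by
  induction l with
  | nil => exact Preserves.one
  | cons k l ih =>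
    rw [List.map_cons, List.prod_cons]
    exact (h k (by simp)).mul (ih fun j hj => h j (by simp [hj]))

theorem Preserves.corner {ι : Type*} {α κ β : ι → Module.End ℂ (MvPolynomial τ ℂ)} {l : List ι}
    (hα : ∀ k ∈ l, Preserves w (α k)) (hκ : ∀ k ∈ l, Preserves w (κ k))
    (hβ : ∀ k ∈ l, Preserves w (β k)) : Preserves w (corner α κ β l) := by
  induction l with
  | nil => exact fun e e' h => absurd (by simp [SpinChain.corner]) h
  | cons k l ih =>
    rw [SpinChain.corner]
    exact ((hα k (by simp)).mul (ih (fun j hj => hα j (by simp [hj]))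
      (fun j hj => hκ j (by simp [hj])) (fun j hj => hβ j (by simp [hj])))).add
      ((hκ k (by simp)).mul (Preserves.list_prod fun j hj => hβ j (by simp [hj])))

theorem preserves_del {s t : τ} (h : s ≠ t) : Preserves (fun e => e t) (del s) := fun e e' he => by
  classical
  rw [del_monomial, coeff_smul, coeff_monomial] at he
  split_ifs at he with h1
  · rw [← h1]; simp [h]
  · simp at he

end Exponents

/-! ### Matrix elements of the factors of the monodromies in the monomial basis. -/

section Monomials

/-- The iterated difference `∑ i, (-1)^i (b choose i) f (a + i)`. -/
def iterDiff (f : ℕ → ℂ) : ℕ → ℕ → ℂ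
  | a, 0 => f a
  | a, b + 1 => iterDiff f a b - iterDiff f (a + 1) b

theorem iterDiff_shift (f : ℕ → ℂ) (a b : ℕ) :
    iterDiff (fun n => f (n + 1)) a b = iterDiff f (a + 1) b := by
  induction b generalizing a with
  | zero => rfl
  | succ b ih => simp only [iterDiff, ih]

theorem iterDiff_sub_shift (f : ℕ → ℂ) (a b : ℕ) :
    iterDiff (fun n => f n - f (n + 1)) a b = iterDiff f a (b + 1) := by
  induction b generalizing a with
  | zero => rfl
  | succ b ih => simp only [iterDiff, ih]

variable {σ : Type*} [DecidableEq σ]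

open Finset in
-- Pulling out one `z_i` either shifts `f` or takes its difference and produces `z_j`; Pascal's rule
-- collects the terms. The induction must let `f` vary.
theorem dilationFun_pow_mul {i j : σ} (h : i ≠ j) (f : ℕ → ℂ) (n : ℕ) (e : σ →₀ ℕ)
    (he : e i = 0) :
    dilationFun i j f (X i ^ n * monomial e 1) =
      ∑ ab ∈ antidiagonal n, n.choose ab.1 •
        (iterDiff f ab.1 ab.2 • (X i ^ ab.1 * (X j ^ ab.2 * monomial e 1))) := by
  induction n generalizing f with
  | zero => simpa [iterDiff] using dilationFun_monomial_of_eq_zero h f e he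
  | succ n ih =>
    have h1 := dilationFun_sub i j f (fun n => f (n + 1))
    rw [pow_succ', mul_assoc, dilationFun_X_mul h, ← LinearMap.sub_apply, ← h1, ih, ih,
      sum_antidiagonal_choose_succ_nsmul
        (fun a b => iterDiff f a b • (X i ^ a * (X j ^ b * monomial e (1 : ℂ)))) n, add_comm,
      mul_sum, mul_sum]
    congr 1
    · refine sum_congr rfl fun ab _ => ?_
      rw [mul_smul_comm, mul_smul_comm, iterDiff_sub_shift, pow_succ']
      congr 2
      ring
    · refine sum_congr rfl fun ab hab => ?_
      rw [mul_smul_comm, mul_smul_comm, iterDiff_shift, pow_succ',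
        Nat.choose_symm_of_eq_add (HasAntidiagonal.mem_antidiagonal.1 hab).symm]
      congr 2
      ring

open Finset in
theorem dilationFun_monomial {i j : σ} (h : i ≠ j) (f : ℕ → ℂ) (e : σ →₀ ℕ) :
    dilationFun i j f (monomial e 1) = ∑ ab ∈ antidiagonal (e i),
      ((e i).choose ab.1 * iterDiff f ab.1 ab.2) •
        monomial (e.erase i + Finsupp.single i ab.1 + Finsupp.single j ab.2) 1 := by
  have h1 : monomial e (1 : ℂ) = X i ^ e i * monomial (e.erase i) 1 := by
    rw [X_pow_eq_monomial, monomial_mul, one_mul, Finsupp.single_add_erase]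
  rw [h1, dilationFun_pow_mul h f _ _ Finsupp.erase_same]
  refine sum_congr rfl fun ab _ => ?_
  rw [X_pow_eq_monomial, X_pow_eq_monomial, monomial_mul, monomial_mul, one_mul, one_mul,
    ← Nat.cast_smul_eq_nsmul ℂ, smul_smul]
  congr 3
  abel

variable {N : ℕ}

theorem permOp_monomial (k : Fin N) (d : Fin N →₀ ℕ) (n : ℕ) :
    permOp k (monomial (d.optionElim n) 1) = monomial ((d.update k n).optionElim (d k)) 1 := by
  suffices h : Finsupp.mapDomain (Equiv.swap (some k) none) (d.optionElim n) =
      (d.update k n).optionElim (d k) by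
    rw [permOp, AlgHom.toLinearMap_apply, rename_monomial, h]
  ext s
  rw [Finsupp.mapDomain_equiv_apply, Equiv.symm_swap]
  cases s with
  | none => simp
  | some j =>
    by_cases hj : j = k
    · subst hj; simp
    · rw [Equiv.swap_apply_of_ne_of_ne (by simpa using hj) (by simp)]
      simp [hj]

open Finset in
theorem permOp_mul_plus_monomial (k : Fin N) (f : ℕ → ℂ) (d : Fin N →₀ ℕ) (m : ℕ) :
    (permOp k * dilationFun none (some k) f) (monomial (d.optionElim m) 1) =
      ∑ ab ∈ antidiagonal m, (m.choose ab.1 * iterDiff f ab.1 ab.2) •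
        monomial ((d.update k ab.1).optionElim (d k + ab.2)) (1 : ℂ) := by
  rw [Module.End.mul_apply, dilationFun_monomial (by simp), map_sum, Finsupp.optionElim_apply_none]
  refine sum_congr rfl fun ab _ => ?_
  have h : (d.optionElim m).erase none + Finsupp.single none ab.1 + Finsupp.single (some k) ab.2 =
      (d + Finsupp.single k ab.2).optionElim ab.1 := by
    ext s; cases s <;> simp [Finsupp.single_apply]
  have h' : (d + Finsupp.single k ab.2).update k ab.1 = d.update k ab.1 := by
    ext j
    by_cases hj : j = k
    · subst hj; simp
    · simp [hj]
  rw [map_smul, h, permOp_monomial, h', Finsupp.add_apply, Finsupp.single_eq_same]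

open Finset in
theorem permOp_mul_minus_monomial (k : Fin N) (f : ℕ → ℂ) (d : Fin N →₀ ℕ) (m : ℕ) :
    (permOp k * dilationFun (some k) none f) (monomial (d.optionElim m) 1) =
      ∑ ab ∈ antidiagonal (d k), ((d k).choose ab.1 * iterDiff f ab.1 ab.2) •
        monomial ((d.update k (m + ab.2)).optionElim ab.1) (1 : ℂ) := by
  rw [Module.End.mul_apply, dilationFun_monomial (by simp), map_sum, Finsupp.optionElim_apply_some]
  refine sum_congr rfl fun ab _ => ?_
  have h : (d.optionElim m).erase (some k) + Finsupp.single (some k) ab.1 +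
      Finsupp.single none ab.2 = (d.update k ab.1).optionElim (m + ab.2) := by
    ext s
    cases s with
    | none => simp
    | some j =>
      by_cases hj : j = k
      · subst hj; simp
      · simp [hj]
  have h' : (d.update k ab.1).update k (m + ab.2) = d.update k (m + ab.2) := by
    ext j
    by_cases hj : j = k
    · subst hj; simp
    · simp [hj]
  rw [map_smul, h, permOp_monomial, h', Finsupp.coe_update, Function.update_self]

theorem exists_of_coeff_sum_monomial {ι : Type*} {s : Finset ι} {c : ι → ℂ} {E : ι → σ →₀ ℕ}
    {e : σ →₀ ℕ} (h : coeff e (∑ x ∈ s, c x • monomial (E x) (1 : ℂ)) ≠ 0) :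
    ∃ x ∈ s, E x = e := by
  rw [coeff_sum] at h
  obtain ⟨x, hx, h⟩ := Finset.exists_ne_zero_of_sum_ne_zero h
  refine ⟨x, hx, ?_⟩
  rw [coeff_smul, coeff_monomial] at h
  by_contra hne
  simp [hne] at h

theorem preserves_plus {j k : Fin N} (h : j ≠ k) (f : ℕ → ℂ) :
    Preserves (fun e => e (some j)) (permOp k * dilationFun none (some k) f) := fun e e' he => by
  rw [← Finsupp.optionElim_some e, permOp_mul_plus_monomial] at he
  obtain ⟨ab, -, rfl⟩ := exists_of_coeff_sum_monomial he
  simp [h]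

theorem preserves_minus {j k : Fin N} (h : j ≠ k) (f : ℕ → ℂ) :
    Preserves (fun e => e (some j)) (permOp k * dilationFun (some k) none f) := fun e e' he => by
  rw [← Finsupp.optionElim_some e, permOp_mul_minus_monomial] at he
  obtain ⟨ab, -, rfl⟩ := exists_of_coeff_sum_monomial he
  simp [h]

/-- The dilation moves part of the exponent of `z_k` to `z_0`; the exchange then gives `z_0` only
what is left at `z_k`. -/
theorem expIn_none_minus {k : Fin N} (f : ℕ → ℂ) {F : Extended N} {D : ℕ}
    (hF : ExpIn (fun e => e (some k)) (Set.Iic D) F) :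
    ExpIn (fun e => e none) (Set.Iic D) ((permOp k * dilationFun (some k) none f) F) :=
  fun e' he => by
    obtain ⟨e, h1, h2⟩ := exists_of_coeff_apply_ne_zero he
    have h3 : e (some k) ≤ D := hF e h1
    rw [← Finsupp.optionElim_some e, permOp_mul_minus_monomial] at h2
    obtain ⟨ab, hab, rfl⟩ := exists_of_coeff_sum_monomial h2
    have := Finset.HasAntidiagonal.mem_antidiagonal.1 hab
    simp only [Finsupp.some_apply] at this
    simp only [Finsupp.optionElim_apply_none, Set.mem_Iic]
    omega

/-- The total degree of an exponent of `ℂ[z_0, …, z_N]`. -/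
def totalDeg (e : Option (Fin N) →₀ ℕ) : ℕ := e none + ∑ j, e (some j)

theorem preserves_totalDeg_plus (k : Fin N) (f : ℕ → ℂ) :
    Preserves totalDeg (permOp k * dilationFun none (some k) f) := fun e e' he => by
  rw [← Finsupp.optionElim_some e, permOp_mul_plus_monomial] at he
  obtain ⟨ab, hab, rfl⟩ := exists_of_coeff_sum_monomial he
  have h1 := Finset.HasAntidiagonal.mem_antidiagonal.1 hab
  have h2 : ∑ j ∈ Finset.univ.erase k, e.some.update k ab.1 j =
      ∑ j ∈ Finset.univ.erase k, e (some j) :=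
    Finset.sum_congr rfl fun j hj => by simp [Finset.ne_of_mem_erase hj]
  simp only [totalDeg, Finsupp.optionElim_apply_none, Finsupp.optionElim_apply_some]
  rw [← Finset.add_sum_erase _ _ (Finset.mem_univ k), h2,
    ← Finset.add_sum_erase _ _ (Finset.mem_univ k)]
  simp
  omega

/-- With the power `q` of `z_k` fixed, `z_0^{n'} z_k^q` goes to terms `z_k^a z_0^{q+b}` with `a + b
= n'`. Hence `a = d k` and `b = n - q` are forced and a single input monomial contributes. -/
theorem coeff_plus (k : Fin N) (f : ℕ → ℂ) {F : Extended N} {q : ℕ}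
    (hF : ExpIn (fun e => e (some k)) {q} F) (d : Fin N →₀ ℕ) (n n' : ℕ) (hn : q ≤ n)
    (hn' : n' + q = n + d k) :
    coeff (d.optionElim n) ((permOp k * dilationFun none (some k) f) F) =
      n'.choose (d k) * iterDiff f (d k) (n' - d k) * coeff ((d.update k q).optionElim n') F := by
  rw [coeff_apply_eq_sum, Finset.sum_eq_single ((d.update k q).optionElim n'), mul_comm,
    permOp_mul_plus_monomial, coeff_sum, Finset.sum_eq_single (d k, n' - d k)]
  · have : ((d.update k q).update k (d k)).optionElim ((d.update k q) k + (n' - d k)) =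
        d.optionElim n := by
      ext s
      cases s with
      | none => simp; omega
      | some j => simp
    rw [coeff_smul, this, coeff_monomial, if_pos rfl, smul_eq_mul, mul_one]
  · intro ab hab hne
    rw [coeff_smul, coeff_monomial, if_neg, smul_zero]
    intro he
    apply hne
    have h1 := DFunLike.congr_fun he (some k)
    have h2 := Finset.HasAntidiagonal.mem_antidiagonal.1 hab
    simp at h1
    ext
    · exact h1
    · simp only; omega
  · intro h
    refine absurd (Finset.HasAntidiagonal.mem_antidiagonal.2 ?_) h
    simp only
    omega
  · intro e he hne
    rw [mul_eq_zero]
    right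
    by_contra h
    have hq : e (some k) = q := hF e (mem_support_iff.1 he)
    rw [← Finsupp.optionElim_some e, permOp_mul_plus_monomial] at h
    obtain ⟨ab, hab, h⟩ := exists_of_coeff_sum_monomial h
    have h1 := DFunLike.congr_fun h none
    have h2 := DFunLike.congr_fun h (some k)
    have h3 := Finset.HasAntidiagonal.mem_antidiagonal.1 hab
    simp only [Finsupp.optionElim_apply_none, Finsupp.optionElim_apply_some, Finsupp.some_apply,
      Finsupp.coe_update, Function.update_self] at h1 h2
    apply hne
    ext s
    cases s with
    | none => simp; omega
    | some j =>
      have h4 := DFunLike.congr_fun h (some j)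
      by_cases hj : j = k
      · subst hj; simp [hq]
      · simpa [hj] using h4
  · intro h
    rw [notMem_support_iff.1 h, zero_mul]

theorem coeff_plus_eq_zero (k : Fin N) (f : ℕ → ℂ) {F : Extended N} {q : ℕ}
    (hF : ExpIn (fun e => e (some k)) {q} F) (d : Fin N →₀ ℕ) (n : ℕ) (hn : n < q) :
    coeff (d.optionElim n) ((permOp k * dilationFun none (some k) f) F) = 0 := by
  by_contra h
  obtain ⟨e, h1, h2⟩ := exists_of_coeff_apply_ne_zero h
  have hq : e (some k) = q := hF e h1
  rw [← Finsupp.optionElim_some e, permOp_mul_plus_monomial] at h2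
  obtain ⟨ab, hab, h⟩ := exists_of_coeff_sum_monomial h2
  have h1 := DFunLike.congr_fun h none
  simp only [Finsupp.optionElim_apply_none, Finsupp.some_apply] at h1
  omega

end Monomials

/-! ### Propagation of decay rates near the diagonal through products of factors. -/

section Decay

open Filter Topology

variable {N : ℕ}

/-- The coefficients of `z_0^n z^d` in `F m`, with `n - m` bounded, are `O(ρ m)`. -/
def Decay (F : ℕ → Extended N) (ρ : ℕ → ℝ) : Prop :=
  ∀ (d : Fin N →₀ ℕ) (K : ℕ), ∃ C : ℝ, ∀ᶠ m in atTop, ∀ n, n ≤ m + K → m ≤ n + K →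
    ‖coeff (d.optionElim n) (F m)‖ ≤ C * ρ m

/-- The matrix elements of `f(z_{0k} ∂_0)` near the diagonal are `O(ρ m)`. -/
def HasRate (f : ℕ → ℂ) (ρ : ℕ → ℝ) : Prop :=
  ∀ j K : ℕ, ∃ C : ℝ, ∀ᶠ m in atTop, ∀ n, n ≤ m + K → m ≤ n + K →
    ‖(n.choose j : ℂ) * iterDiff f j (n - j)‖ ≤ C * ρ m

/-- The operator `A`, applied to polynomials with a fixed power of `z_k`, multiplies rates of decay
by `ρ`. -/
def StepRate (A : Module.End ℂ (Extended N)) (k : Fin N) (ρ : ℕ → ℝ) : Prop :=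
  ∀ (F : ℕ → Extended N) (ρ' : ℕ → ℝ) (q : ℕ), (∀ m, 0 ≤ ρ' m) →
    (∀ m, ExpIn (fun e => e (some k)) {q} (F m)) → Decay F ρ' →
    Decay (fun m => A (F m)) (fun m => ρ' m * ρ m)

variable {F G : ℕ → Extended N} {ρ : ℕ → ℝ}

theorem Decay.add (hF : Decay F ρ) (hG : Decay G ρ) : Decay (fun m => F m + G m) ρ := fun d K => by
  obtain ⟨C, hC⟩ := hF d K
  obtain ⟨C', hC'⟩ := hG d K
  refine ⟨C + C', ?_⟩
  filter_upwards [hC, hC'] with m h h' n h1 h2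
  rw [coeff_add, add_mul]
  exact (norm_add_le _ _).trans (add_le_add (h n h1 h2) (h' n h1 h2))

theorem Decay.smul (c : ℂ) (hF : Decay F ρ) : Decay (fun m => c • F m) ρ := fun d K => by
  obtain ⟨C, hC⟩ := hF d K
  refine ⟨‖c‖ * C, ?_⟩
  filter_upwards [hC] with m h n h1 h2
  rw [coeff_smul, smul_eq_mul, norm_mul, mul_assoc]
  exact mul_le_mul_of_nonneg_left (h n h1 h2) (norm_nonneg c)

theorem Decay.del (k : Fin N) (hF : Decay F ρ) :
    Decay (fun m => SpinChain.del (some k) (F m)) ρ := fun d K => by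
  obtain ⟨C, hC⟩ := hF (d + Finsupp.single k 1) K
  refine ⟨C * ‖(d k + 1 : ℂ)‖, ?_⟩
  filter_upwards [hC] with m h n h1 h2
  have he : d.optionElim n + Finsupp.single (some k) 1 =
      (d + Finsupp.single k 1).optionElim n := by
    ext s; cases s <;> simp [Finsupp.single_apply]
  rw [del_apply, coeff_pderiv, he, norm_mul, Finsupp.optionElim_apply_some, mul_right_comm]
  exact mul_le_mul_of_nonneg_right (h n h1 h2) (norm_nonneg _)

theorem Decay.tendsto_coeff (hF : Decay F ρ) (hρ : Tendsto ρ atTop (𝓝 0)) (d : Fin N →₀ ℕ) :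
    Tendsto (fun m => coeff (d.optionElim m) (F (m + 1))) atTop (𝓝 0) := by
  obtain ⟨C, hC⟩ := hF d 1
  rw [tendsto_zero_iff_norm_tendsto_zero]
  have h1 : Tendsto (fun m => C * ρ (m + 1)) atTop (𝓝 0) := by
    simpa using (hρ.comp (tendsto_add_atTop_nat 1)).const_mul C
  refine squeeze_zero' (Eventually.of_forall fun m => norm_nonneg _) ?_ h1
  filter_upwards [(tendsto_add_atTop_nat 1).eventually hC] with m h
  exact h m (by omega) (by omega)

theorem Decay.summable_coeff (hF : Decay F ρ) (hρ : Summable ρ) (d : Fin N →₀ ℕ) :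
    Summable (fun m => coeff (d.optionElim m) (F m)) := by
  obtain ⟨C, hC⟩ := hF d 0
  refine Summable.of_norm_bounded_eventually_nat (hρ.mul_left C) ?_
  filter_upwards [hC] with m h
  exact h m (by omega) (by omega)

theorem decay_auxMul (d : Fin N →₀ ℕ) :
    Decay (fun m => auxMul m (monomial d 1)) (fun _ => 1) := fun d' K => by
  classical
  refine ⟨1, Eventually.of_forall fun m n _ _ => ?_⟩
  simp only [auxMul_monomial, coeff_monomial]
  split_ifs <;> simp

theorem expIn_auxMul (d : Fin N →₀ ℕ) (k : Fin N) (m : ℕ) :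
    ExpIn (fun e => e (some k)) {d k} (auxMul m (monomial d 1)) := by
  rw [auxMul_monomial]
  simpa using expIn_monomial (w := fun e => e (some k)) (d.optionElim m)

/-- By `coeff_plus` each output coefficient is one matrix element times one input coefficient, so
the rates multiply. -/
theorem HasRate.stepRate {f : ℕ → ℂ} (hf : HasRate f ρ) (hρ : ∀ m, 0 ≤ ρ m) (k : Fin N) :
    StepRate (permOp k * dilationFun none (some k) f) k ρ := by
  intro F ρ' q hρ' hq hF d K
  -- The input power is `n' = n + d k - q`, so enlarging the window by `d k + q` keeps it near the
  -- diagonal.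
  obtain ⟨C, hC⟩ := hf (d k) (K + d k + q)
  obtain ⟨C', hC'⟩ := hF (d.update k q) (K + d k + q)
  refine ⟨|C'| * |C|, ?_⟩
  filter_upwards [hC, hC'] with m h h' n h1 h2
  rcases lt_or_ge n q with hn | hn
  · rw [coeff_plus_eq_zero k f (hq m) d n hn, norm_zero]
    have := hρ m
    have := hρ' m
    positivity
  · obtain ⟨n', hn'⟩ : ∃ n', n' + q = n + d k := ⟨n + d k - q, by omega⟩
    rw [coeff_plus k f (hq m) d n n' hn hn', norm_mul]
    have e1 := (h n' (by omega) (by omega)).trans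
      (mul_le_mul_of_nonneg_right (le_abs_self C) (hρ m))
    have e2 := (h' n' (by omega) (by omega)).trans
      (mul_le_mul_of_nonneg_right (le_abs_self C') (hρ' m))
    calc _ ≤ (|C| * ρ m) * (|C'| * ρ' m) :=
          mul_le_mul e1 e2 (norm_nonneg _) ((norm_nonneg _).trans e1)
      _ = _ := by ring

variable {A : Module.End ℂ (Extended N)} {k : Fin N}

theorem StepRate.smul (c : ℂ) (hA : StepRate A k ρ) : StepRate (c • A) k ρ :=
  fun F ρ' q h1 h2 h3 => (hA F ρ' q h1 h2 h3).smul c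

theorem StepRate.del_neg (hA : StepRate A k ρ) : StepRate (-(SpinChain.del (some k) * A)) k ρ :=
  fun F ρ' q h1 h2 h3 => by
    have := ((hA F ρ' q h1 h2 h3).del k).smul (-1)
    simp only [neg_smul, one_smul] at this
    exact this

section Products

variable {α κ β : Fin N → Module.End ℂ (Extended N)} {r : Fin N → ℕ → ℝ}

/-- When factor `k` acts, the factors already applied belong to other sites and have left the power
of `z_k` at its initial value, as `StepRate` requires. -/
theorem Decay.list_prod (hr : ∀ k m, 0 ≤ r k m) (hα : ∀ k, StepRate (α k) k (r k))
    (hp : ∀ j k, j ≠ k → Preserves (fun e => e (some j)) (α k)) {l : List (Fin N)} (hl : l.Nodup)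
    (hF : Decay F fun _ => 1)
    (hq : ∀ k, ∃ q, ∀ m, ExpIn (fun e => e (some k)) {q} (F m)) :
    Decay (fun m => (l.map α).prod (F m)) (fun m => (l.map fun k => r k m).prod) := by
  induction l with
  | nil => simpa using hF
  | cons k l ih =>
    rw [List.nodup_cons] at hl
    obtain ⟨q, hq⟩ := hq k
    have h1 : ∀ m, 0 ≤ (l.map fun k => r k m).prod := fun m =>
      List.prod_nonneg fun x hx => by
        obtain ⟨j, -, rfl⟩ := List.mem_map.1 hx
        exact hr j m
    have h2 : Preserves (fun e => e (some k)) (l.map α).prod :=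
      Preserves.list_prod fun j hj => hp k j fun e => hl.1 (e ▸ hj)
    have h3 := hα k _ _ q h1 (fun m => h2.expIn (hq m)) (ih hl.2)
    simpa only [List.map_cons, List.prod_cons, Module.End.mul_apply, mul_comm] using h3

theorem Decay.corner (hr : ∀ k m, 0 ≤ r k m) (hα : ∀ k, StepRate (α k) k (r k))
    (hκ : ∀ k, StepRate (κ k) k (r k)) (hβ : ∀ k, StepRate (β k) k (r k))
    (pα : ∀ j k, j ≠ k → Preserves (fun e => e (some j)) (α k))
    (pκ : ∀ j k, j ≠ k → Preserves (fun e => e (some j)) (κ k))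
    (pβ : ∀ j k, j ≠ k → Preserves (fun e => e (some j)) (β k))
    {l : List (Fin N)} (hl : l.Nodup) (hF : Decay F fun _ => 1)
    (hq : ∀ k, ∃ q, ∀ m, ExpIn (fun e => e (some k)) {q} (F m)) :
    Decay (fun m => corner α κ β l (F m)) (fun m => (l.map fun k => r k m).prod) := by
  induction l with
  | nil => exact fun d K => ⟨0, Eventually.of_forall fun m n _ _ => by simp [SpinChain.corner]⟩
  | cons k l ih =>
    rw [List.nodup_cons] at hl
    obtain ⟨q, hqk⟩ := hq k
    have h1 : ∀ m, 0 ≤ (l.map fun k => r k m).prod := fun m =>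
      List.prod_nonneg fun x hx => by
        obtain ⟨j, -, rfl⟩ := List.mem_map.1 hx
        exact hr j m
    have hne : ∀ j ∈ l, k ≠ j := fun j hj e => hl.1 (e ▸ hj)
    have h2 : Preserves (fun e => e (some k)) (SpinChain.corner α κ β l) :=
      Preserves.corner (fun j hj => pα k j (hne j hj)) (fun j hj => pκ k j (hne j hj))
        (fun j hj => pβ k j (hne j hj))
    have h2' : Preserves (fun e => e (some k)) (l.map β).prod :=
      Preserves.list_prod fun j hj => pβ k j (hne j hj)
    have h3 := hα k _ _ q h1 (fun m => h2.expIn (hqk m)) (ih hl.2)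
    have h4 := hκ k _ _ q h1 (fun m => h2'.expIn (hqk m)) (Decay.list_prod hr hβ pβ hl.2 hF hq)
    simpa only [SpinChain.corner, List.map_cons, List.prod_cons, Module.End.mul_apply, mul_comm,
      LinearMap.add_apply] using h3.add h4

end Products

/-- The extension of a limit from monomials to all polynomials. -/
theorem tendsto_coeff_of_monomial {K : Module.End ℂ (Extended N)}
    (h : ∀ d' d, Tendsto (fun m => coeff (Finsupp.optionElim m d)
      (K (auxMul (m + 1) (monomial d' 1)))) atTop (𝓝 0)) (p : MvPolynomial (Fin N) ℂ)
    (d : Fin N →₀ ℕ) :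
    Tendsto (fun m => coeff (Finsupp.optionElim m d) (K (auxMul (m + 1) p))) atTop (𝓝 0) := by
  induction p using MvPolynomial.induction_on' with
  | monomial d' c =>
    have h1 : monomial d' c = c • monomial d' (1 : ℂ) := by
      rw [smul_monomial, smul_eq_mul, mul_one]
    rw [h1]
    simp only [map_smul, coeff_smul, smul_eq_mul]
    simpa using (h d' d).const_mul c
  | add p p' hp hp' =>
    simp only [map_add, coeff_add]
    simpa using hp.add hp'

/-- Conservation of total degree confines every diagonal term to the degree of the input monomial.
Only finitely many coefficients occur, so the limit is a polynomial. -/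
theorem exists_coeffHasSum {A : Module.End ℂ (Extended N)} (hA : Preserves totalDeg A)
    (d' : Fin N →₀ ℕ)
    (hs : ∀ d : Fin N →₀ ℕ, Summable fun m =>
      coeff (d.optionElim m) (A (auxMul m (monomial d' 1)))) :
    ∃ q, CoeffHasSum (fun m => traceTerm A m (monomial d' 1)) q := by
  classical
  have h0 : ∀ (d : Fin N →₀ ℕ) m, ∑ j, d j ≠ ∑ j, d' j →
      coeff (d.optionElim m) (A (auxMul m (monomial d' 1))) = 0 := fun d m h => by
    by_contra hne
    rw [auxMul_monomial] at hne
    have := hA _ _ hne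
    simp [totalDeg] at this
    exact h this
  refine ⟨∑ d ∈ Finset.univ.finsuppAntidiag (∑ j, d' j), monomial d
    (∑' m, coeff (d.optionElim m) (A (auxMul m (monomial d' 1)))), fun d => ?_⟩
  simp only [traceTerm_eq, coeff_auxCoeff, coeff_sum, coeff_monomial, Finset.sum_ite_eq',
    Finset.mem_finsuppAntidiag]
  split_ifs with h
  · exact (hs d).hasSum
  · have h1 : ∑ j, d j ≠ ∑ j, d' j := fun e => h ⟨e, Finset.subset_univ _⟩
    simp only [h0 d _ h1]
    exact hasSum_zero

end Decay

/-! ### Asymptotics of the matrix elements of `R⁺`. -/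

section Rates

open Filter Topology Asymptotics

/-- A form of the Chu–Vandermonde identity. For bounded `i` it reduces the size of the matrix
elements to that of `(b - c)_m / (b)_m`. -/
theorem iterDiff_pochRatio {b : ℂ} (hb : ∀ n : ℕ, b ≠ -n) (c : ℂ) (i j : ℕ) :
    iterDiff (pochRatio c b) i j = (ascPochhammer ℂ i).eval c * (ascPochhammer ℂ j).eval (b - c) /
      (ascPochhammer ℂ (i + j)).eval b := by
  induction j generalizing i with
  | zero => simp [iterDiff, pochRatio]
  | succ j ih =>
    have h1 := ascPochhammer_eval_ne_zero hb (i + j)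
    have h2 : b + (i + j : ℕ) ≠ 0 := fun h => hb (i + j) (by linear_combination h)
    rw [iterDiff, ih, ih, ← add_assoc, Nat.add_right_comm i 1 j, ascPochhammer_succ_eval,
      ascPochhammer_succ_eval, ascPochhammer_succ_eval]
    field_simp
    push_cast
    ring

theorem eventually_norm_add_le (x y : ℂ) : ∀ᶠ n : ℕ in atTop, ‖x + n‖ ≤ 2 * ‖y + n‖ := by
  filter_upwards [(tendsto_natCast_atTop_atTop (R := ℝ)).eventually_ge_atTop (‖x‖ + 2 * ‖y‖)]
    with n hn
  have h1 := norm_add_le x n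
  have h2 := norm_sub_le (y + n) y
  rw [add_sub_cancel_left] at h2
  rw [Complex.norm_natCast] at h1 h2
  linarith

/-- Consecutive terms of `ρ` eventually differ by a factor of at most two. -/
def SlowlyVarying (ρ : ℕ → ℝ) : Prop := ∀ᶠ n in atTop, ρ n ≤ 2 * ρ (n + 1) ∧ ρ (n + 1) ≤ 2 * ρ n

theorem SlowlyVarying.window {ρ : ℕ → ℝ} (h : SlowlyVarying ρ) (hρ : ∀ m, 0 ≤ ρ m) (K : ℕ) :
    ∀ᶠ m in atTop, ∀ n, n ≤ m + K → m ≤ n + K → ρ n ≤ 2 ^ K * ρ m := by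
  obtain ⟨M, hM⟩ := eventually_atTop.1 h
  have h1 : ∀ a, M ≤ a → ∀ i, ρ a ≤ 2 ^ i * ρ (a + i) ∧ ρ (a + i) ≤ 2 ^ i * ρ a := by
    intro a ha i
    induction i with
    | zero => simp
    | succ i ih =>
      obtain ⟨e1, e2⟩ := hM (a + i) (by omega)
      have : (0 : ℝ) < 2 ^ i := by positivity
      rw [pow_succ, ← add_assoc]
      constructor
      · nlinarith
      · nlinarith
  filter_upwards [eventually_ge_atTop (M + K)] with m hm n h2 h3
  have hle : ∀ i ≤ K, (2 : ℝ) ^ i * ρ m ≤ 2 ^ K * ρ m := fun i hi =>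
    mul_le_mul_of_nonneg_right (pow_le_pow_right₀ one_le_two hi) (hρ m)
  rcases le_total m n with h | h
  · obtain ⟨i, rfl⟩ := Nat.exists_eq_add_of_le h
    exact (h1 m (by omega) i).2.trans (hle i (by omega))
  · obtain ⟨i, rfl⟩ := Nat.exists_eq_add_of_le h
    exact (h1 n (by omega) i).1.trans (hle i (by omega))

theorem slowlyVarying_pochRatio {b : ℂ} (hb : ∀ n : ℕ, b ≠ -n) (x : ℂ) :
    SlowlyVarying fun m => ‖pochRatio x b m‖ := by
  filter_upwards [eventually_norm_add_le x b, eventually_norm_add_le b x] with n h1 h2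
  have h3 : 0 < ‖b + n‖ := norm_pos_iff.2 fun h => hb n (by linear_combination h)
  rw [pochRatio_succ, norm_mul, norm_div]
  constructor
  · have : 1 ≤ 2 * (‖x + n‖ / ‖b + n‖) := by
      rw [← mul_div_assoc, le_div_iff₀ h3]; linarith
    nlinarith [norm_nonneg (pochRatio x b n)]
  · have : ‖x + n‖ / ‖b + n‖ ≤ 2 := by
      rw [div_le_iff₀ h3]; linarith
    nlinarith [norm_nonneg (pochRatio x b n)]

/-- The binomial grows like `n^j`, as do the `j` missing factors of the Pochhammer symbol; they are
compared one at a time. Avoiding division by `(x)_n` covers the case in which it eventually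
vanishes. -/
theorem eventually_choose_mul_le (x : ℂ) (j : ℕ) : ∃ C : ℝ, 0 ≤ C ∧ ∀ᶠ n : ℕ in atTop,
    ‖(n.choose j : ℂ) * (ascPochhammer ℂ (n - j)).eval x‖ ≤
      C * ‖(ascPochhammer ℂ n).eval x‖ := by
  induction j with
  | zero => exact ⟨1, zero_le_one, Eventually.of_forall fun n => by simp⟩
  | succ j ih =>
    obtain ⟨C, hC0, hC⟩ := ih
    refine ⟨2 * C, by positivity, ?_⟩
    filter_upwards [hC, eventually_norm_add_le (-j) (x - (j + 1)), eventually_ge_atTop (j + 1)]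
      with n h1 h2 h3
    obtain ⟨p, rfl⟩ := Nat.exists_eq_add_of_le h3
    have e1 : j + 1 + p - j = p + 1 := by omega
    have e2 : j + 1 + p - (j + 1) = p := by omega
    have e3 : ((j + 1 + p).choose (j + 1) : ℂ) * (j + 1) =
        (j + 1 + p).choose j * (p + 1) := by
      have := Nat.choose_succ_right_eq (j + 1 + p) j
      rw [e1] at this
      exact_mod_cast this
    rw [e1, ascPochhammer_succ_eval] at h1
    rw [e2]
    have e4 : (-j + (j + 1 + p : ℕ) : ℂ) = p + 1 := by push_cast; ring
    have e5 : (x - (j + 1) + (j + 1 + p : ℕ) : ℂ) = x + p := by push_cast; ring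
    rw [e4, e5] at h2
    set a := (ascPochhammer ℂ p).eval x
    have hj : (1 : ℝ) ≤ ‖(j + 1 : ℂ)‖ := by
      have : (j + 1 : ℂ) = ((j + 1 : ℕ) : ℂ) := by push_cast; rfl
      rw [this, Complex.norm_natCast]
      push_cast
      linarith [(Nat.cast_nonneg j : (0 : ℝ) ≤ j)]
    calc ‖((j + 1 + p).choose (j + 1) : ℂ) * a‖
        ≤ ‖((j + 1 + p).choose (j + 1) : ℂ) * a‖ * ‖(j + 1 : ℂ)‖ :=
          le_mul_of_one_le_right (norm_nonneg _) hj
      _ = ‖((j + 1 + p).choose j : ℂ) * a‖ * ‖(p + 1 : ℂ)‖ := by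
          rw [← norm_mul, ← norm_mul]
          congr 1
          linear_combination a * e3
      _ ≤ ‖((j + 1 + p).choose j : ℂ) * a‖ * (2 * ‖x + p‖) :=
          mul_le_mul_of_nonneg_left h2 (norm_nonneg _)
      _ = 2 * ‖((j + 1 + p).choose j : ℂ) * (a * (x + p))‖ := by
          simp only [norm_mul]; ring
      _ ≤ 2 * C * _ := by rw [mul_assoc]; exact mul_le_mul_of_nonneg_left h1 zero_le_two

/-- The closed form and the binomial bound give the rate at `n`; slow variation moves it to `m` at
the cost of `2 ^ K`. -/
theorem hasRate_pochRatio {b : ℂ} (hb : ∀ n : ℕ, b ≠ -n) (c : ℂ) :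
    HasRate (pochRatio c b) fun m => ‖pochRatio (b - c) b m‖ := by
  intro j K
  obtain ⟨C, hC0, hC⟩ := eventually_choose_mul_le (b - c) j
  obtain ⟨M, hM⟩ := eventually_atTop.1 hC
  refine ⟨‖(ascPochhammer ℂ j).eval c‖ * C * 2 ^ K, ?_⟩
  filter_upwards [(slowlyVarying_pochRatio hb (b - c)).window (fun m => norm_nonneg _) K,
    eventually_ge_atTop (M + K + j)] with m h1 h2 n h3 h4
  have h5 : 0 < ‖(ascPochhammer ℂ n).eval b‖ := norm_pos_iff.2 (ascPochhammer_eval_ne_zero hb n)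
  rw [iterDiff_pochRatio hb, Nat.add_sub_cancel' (by omega)]
  calc _ = ‖(ascPochhammer ℂ j).eval c‖ *
        (‖(n.choose j : ℂ) * (ascPochhammer ℂ (n - j)).eval (b - c)‖ /
          ‖(ascPochhammer ℂ n).eval b‖) := by
        simp only [norm_mul, norm_div]; ring
    _ ≤ ‖(ascPochhammer ℂ j).eval c‖ * (C * ‖pochRatio (b - c) b n‖) := by
        rw [pochRatio, norm_div, ← mul_div_assoc C]
        gcongr
        exact hM n (by omega)
    _ ≤ ‖(ascPochhammer ℂ j).eval c‖ * (C * (2 ^ K * ‖pochRatio (b - c) b m‖)) := by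
        gcongr
        exact h1 n h3 h4
    _ = _ := by ring

theorem HasRate.mono {f : ℕ → ℂ} {ρ ρ' : ℕ → ℝ} (h : HasRate f ρ) (hρ : ∀ m, 0 ≤ ρ m)
    (hle : ∃ C : ℝ, ∀ᶠ m in atTop, ρ m ≤ C * ρ' m) : HasRate f ρ' := by
  intro j K
  obtain ⟨C, hC⟩ := h j K
  obtain ⟨C', hC'⟩ := hle
  refine ⟨|C| * C', ?_⟩
  filter_upwards [hC, hC'] with m h1 h2 n h3 h4
  calc _ ≤ C * ρ m := h1 n h3 h4
    _ ≤ |C| * ρ m := mul_le_mul_of_nonneg_right (le_abs_self C) (hρ m)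
    _ ≤ |C| * (C' * ρ' m) := mul_le_mul_of_nonneg_left h2 (abs_nonneg C)
    _ = _ := by ring

/-- Compares the rate at `u` with that at `u - 1`. The reverse bound fails for `x = 0`, where the
left side vanishes for `m ≥ 1`; this is why `u - 1` is the dominating point. -/
theorem eventually_pochRatio_le {b : ℂ} (hb : ∀ n : ℕ, b ≠ -n) (x : ℂ) :
    ∃ C : ℝ, ∀ᶠ m in atTop, ‖pochRatio x b m‖ ≤ C * ‖pochRatio (x + 1) (b + 1) m‖ := by
  refine ⟨‖x / b‖ * 2, ?_⟩
  filter_upwards [eventually_norm_add_le b x] with n h1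
  have h0 : b ≠ 0 := by simpa using hb 0
  have h3 : b + n ≠ 0 := fun h => hb n (by linear_combination h)
  have h4 : x + n ≠ 0 := fun h => by
    rw [h, norm_zero, mul_zero, norm_le_zero_iff] at h1
    exact h3 h1
  have e1 := ascPochhammer_eval_add_one x n
  have e2 := ascPochhammer_eval_add_one b n
  have h5 := ascPochhammer_eval_ne_zero hb n
  have h6 : (ascPochhammer ℂ n).eval (b + 1) ≠ 0 := fun h => by
    rw [h, mul_zero] at e2
    exact mul_ne_zero h5 h3 e2.symm
  have e3 : pochRatio x b n = x / b * ((b + n) / (x + n)) * pochRatio (x + 1) (b + 1) n := by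
    rw [pochRatio, pochRatio]
    field_simp
    linear_combination (ascPochhammer ℂ n).eval (x + 1) * x * e2 -
      b * (ascPochhammer ℂ n).eval (b + 1) * e1
  rw [e3, norm_mul, norm_mul, norm_div (b + n)]
  have h7 : 0 < ‖x + n‖ := norm_pos_iff.2 h4
  gcongr
  rwa [div_le_iff₀ h7]

theorem ascPochhammer_eval_eq_prod_range (s : ℂ) (n : ℕ) :
    (ascPochhammer ℂ n).eval s = ∏ j ∈ Finset.range n, (s + j) := by
  induction n with
  | zero => simp
  | succ n ih => rw [ascPochhammer_succ_eval, ih, Finset.prod_range_succ]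

theorem gammaSeq_eq (s : ℂ) (n : ℕ) :
    Complex.GammaSeq s n = (n : ℂ) ^ s * n.factorial / (ascPochhammer ℂ (n + 1)).eval s := by
  rw [Complex.GammaSeq, ascPochhammer_eval_eq_prod_range]

/-- Euler's limit formula: the ratio is `n^{-c}` times a quotient of two `GammaSeq` that converges.
The index `n + 1` matches the number of factors in `GammaSeq`. -/
theorem pochRatio_isBigO {b : ℂ} (hb : ∀ n : ℕ, b ≠ -n) (c : ℂ) :
    (fun n => pochRatio (b - c) b (n + 1)) =O[atTop] fun n : ℕ => (n : ℝ) ^ (-c.re) := by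
  by_cases hx : ∀ n : ℕ, b - c ≠ -n
  · have h1 : Tendsto (fun n => Complex.GammaSeq b n / Complex.GammaSeq (b - c) n) atTop
        (𝓝 (Complex.Gamma b / Complex.Gamma (b - c))) :=
      (Complex.GammaSeq_tendsto_Gamma b).div (Complex.GammaSeq_tendsto_Gamma (b - c))
        (Complex.Gamma_ne_zero hx)
    have h2 : (fun n : ℕ => ((n : ℂ) ^ (-c))) =O[atTop] fun n : ℕ => (n : ℝ) ^ (-c.re) := by
      refine IsBigO.of_bound 1 ?_
      filter_upwards [eventually_gt_atTop 0] with n hn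
      rw [Complex.norm_natCast_cpow_of_pos hn, Complex.neg_re, one_mul]
      exact le_abs_self _
    have h3 := h2.mul (h1.isBigO_one ℝ)
    simp only [mul_one] at h3
    refine h3.congr' ?_ EventuallyEq.rfl
    filter_upwards [eventually_gt_atTop 0] with n hn
    have hn' : (n : ℂ) ≠ 0 := by exact_mod_cast hn.ne'
    have hf : (n.factorial : ℂ) ≠ 0 := by exact_mod_cast n.factorial_ne_zero
    have e1 : (n : ℂ) ^ (b - c) ≠ 0 := by simp [Complex.cpow_eq_zero_iff, hn']
    have e2 : (n : ℂ) ^ b = (n : ℂ) ^ (b - c) * (n : ℂ) ^ c := by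
      rw [← Complex.cpow_add _ _ hn', sub_add_cancel]
    have e3 : (n : ℂ) ^ (-c) * (n : ℂ) ^ c = 1 := by
      rw [← Complex.cpow_add _ _ hn', neg_add_cancel, Complex.cpow_zero]
    have e4 := ascPochhammer_eval_ne_zero hb (n + 1)
    have e5 := ascPochhammer_eval_ne_zero hx (n + 1)
    rw [gammaSeq_eq, gammaSeq_eq, pochRatio, e2]
    field_simp
    exact e3
  -- At a pole of `Γ(b - c)` the numerator contains the factor zero for all large `n`.
  · push Not at hx
    obtain ⟨p, hp⟩ := hx
    refine (isBigO_zero _ _).congr' ?_ EventuallyEq.rfl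
    filter_upwards [eventually_ge_atTop p] with n hn
    have : (ascPochhammer ℂ (n + 1)).eval (b - c) = 0 := by
      rw [ascPochhammer_eval_eq_prod_range, Finset.prod_eq_zero (i := p)]
      · simp; omega
      · rw [hp]; ring
    rw [pochRatio, this, zero_div]

theorem summable_prod_norm_pochRatio {ι : Type*} [Fintype ι] {b c : ι → ℂ}
    (hb : ∀ k, ∀ n : ℕ, b k ≠ -n) (hc : 1 < (∑ k, c k).re) :
    Summable fun m => ∏ k, ‖pochRatio (b k - c k) (b k) m‖ := by
  rw [← summable_nat_add_iff 1]
  have h : (fun n : ℕ => ∏ k, ‖pochRatio (b k - c k) (b k) (n + 1)‖) =O[atTop]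
      fun n : ℕ => ∏ k, (n : ℝ) ^ (-(c k).re) :=
    IsBigO.finsetProd fun k _ => (pochRatio_isBigO (hb k) (c k)).norm_left
  have h2 : (fun n : ℕ => ∏ k, ‖pochRatio (b k - c k) (b k) (n + 1)‖) =O[atTop]
      fun n : ℕ => (n : ℝ) ^ (-(∑ k, c k).re) := by
    refine h.congr' EventuallyEq.rfl ?_
    filter_upwards [eventually_gt_atTop 0] with n hn
    rw [← Real.rpow_sum_of_pos (by exact_mod_cast hn), Finset.sum_neg_distrib, Complex.re_sum]
  exact summable_of_isBigO_nat (Real.summable_nat_rpow.2 (by linarith)) h2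

end Rates

/-! ### Bounds on the power of `z_0` for the factors of the `Q₋` monodromy. -/

section Minus

variable {N : ℕ}

/-- The power of `z_0` in the values of `A` is bounded by the power of `z_k` in its arguments. -/
def Caps (k : Fin N) (A : Module.End ℂ (Extended N)) : Prop :=
  ∀ F D, ExpIn (fun e => e (some k)) (Set.Iic D) F → ExpIn (fun e => e none) (Set.Iic D) (A F)

theorem caps_minus (k : Fin N) (f : ℕ → ℂ) : Caps k (permOp k * dilationFun (some k) none f) :=
  fun _ _ hF => expIn_none_minus f hF

variable {k : Fin N} {A B : Module.End ℂ (Extended N)}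

theorem Caps.smul (c : ℂ) (hA : Caps k A) : Caps k (c • A) := fun F D hF e he =>
  hA F D hF e (by
    rw [LinearMap.smul_apply, coeff_smul] at he
    exact right_ne_zero_of_mul he)

theorem Caps.neg_mul_del (hA : Caps k A) : Caps k (-(A * del (some k))) := fun F D hF e he => by
  refine hA (del (some k) F) D (fun e' he' => ?_) e (by simpa [Module.End.mul_apply] using he)
  rw [del_apply, coeff_pderiv] at he'
  have := hF _ (left_ne_zero_of_mul he')
  simp only [Finsupp.add_apply, Finsupp.single_eq_same, Set.mem_Iic] at this ⊢
  omega

theorem Caps.coeff_eq_zero (hA : Caps k A) (hB : Preserves (fun e => e (some k)) B)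
    {F : Extended N} {D : ℕ} (hF : ExpIn (fun e => e (some k)) (Set.Iic D) F) (d : Fin N →₀ ℕ)
    {m : ℕ} (hm : D < m) : coeff (d.optionElim m) ((A * B) F) = 0 := by
  by_contra h
  have := hA _ D (hB.expIn hF) _ h
  simp at this
  omega

end Minus

open Filter Topology

variable {N : ℕ} (l δ : Fin N → ℂ)

theorem prod_smul_finRange (c : Fin N → ℂ) (B : Fin N → Module.End ℂ (Extended N)) :
    ((List.finRange N).map fun k => c k • B k).prod =
      (∏ k, c k) • ((List.finRange N).map B).prod := by
  rw [Fin.prod_univ_def]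
  exact prod_smul_list c B _

/-! ### Existence of `Q₋` and its Baxter equation. -/

section QMinus

theorem monodromyMinus_eq (u : ℂ) : monodromyMinus l δ u =
    ((List.finRange N).map fun k => permOp k * Rminus k (l k) (u + δ k)).prod := by
  rw [monodromyMinus, List.ofFn_eq_map]

/-- The off-diagonal part of the triangular form of `R⁻ L`. -/
noncomputable def cornerMinus (u : ℂ) : Module.End ℂ (Extended N) :=
  corner (fun k => (u + δ k + l k) • (permOp k * Rminus k (l k) (u + 1 + δ k)))
    (fun k => -(permOp k * Rminus k (l k) (u + δ k) * del (some k)))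
    (fun k => (u + δ k - l k) • (permOp k * Rminus k (l k) (u - 1 + δ k))) (List.finRange N)

theorem monodromyMinus_mul_transferMatrixExt (hl : ∀ (k : Fin N) (n : ℕ), 2 * l k ≠ -(n : ℂ))
    (u : ℂ) : monodromyMinus l δ u * transferMatrixExt l δ u =
      DeltaPlus l δ u • monodromyMinus l δ (u + 1) + DeltaMinus l δ u • monodromyMinus l δ (u - 1) +
        (mulZ none * cornerMinus l δ u - cornerMinus l δ u * mulZ none) := by
  have key : ∀ k, Matrix.diagonal (fun _ => permOp k * Rminus k (l k) (u + δ k)) *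
      lax (some k) (u + δ k + l k) (u + δ k - l k) * lowerUni (mulZ none) =
      lowerUni (mulZ none) * upperTri
        ((u + δ k + l k) • (permOp k * Rminus k (l k) (u + 1 + δ k)))
        (-(permOp k * Rminus k (l k) (u + δ k) * del (some k)))
        ((u + δ k - l k) • (permOp k * Rminus k (l k) (u - 1 + δ k))) := by
    intro k
    have e : u + δ k + l k - (u + δ k - l k) = 2 * l k := by ring
    have hc : ∀ n : ℕ, u + δ k + l k - (u + δ k - l k) ≠ -n := by rw [e]; exact hl k
    have h := permOp_mul_mul_lax (k := k) (f := pochRatio (u + δ k + l k) (2 * l k))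
      (g := fun n => (u + δ k + l k) * pochRatio (u + 1 + δ k + l k) (2 * l k) n)
      (g' := fun n => (u + δ k - l k) * pochRatio (u - 1 + δ k + l k) (2 * l k) n)
      (up := u + δ k + l k) (um := u + δ k - l k)
      (fun n => by rw [e, pochRatio_rec _ (hl k)])
      (fun n => by
        rw [← pochRatio_add_one_left]
        ring_nf)
      (fun n => by
        have := pochRatio_sub_one_left hc n
        rw [e] at this
        rw [this]
        ring_nf)
    rwa [dilationFun_smul, dilationFun_smul, mul_smul_comm, mul_smul_comm] at h
  have h := prod_mul_trace_prod key (fun j k hjk => lax_commute_permOp_mul_minus hjk _ _ _)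
    (List.nodup_finRange N)
  rw [prod_smul_finRange, prod_smul_finRange] at h
  rw [monodromyMinus_eq, monodromyMinus_eq, monodromyMinus_eq]
  exact h

variable {l δ}

/-- Supplies the leftmost factor, which bounds the power of `z_0`. For an empty chain the monodromy
is the identity and its trace diverges. -/
theorem exists_finRange_eq_cons (hN : 0 < N) :
    ∃ k t, List.finRange N = k :: t ∧ (k :: t).Nodup := by
  have h := List.nodup_finRange N
  cases hf : List.finRange N with
  | nil =>
    have := congrArg List.length hf
    simp at this
    omega
  | cons k t => exact ⟨k, t, rfl, hf ▸ h⟩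

theorem expIn_auxMul_Iic (k : Fin N) (p : MvPolynomial (Fin N) ℂ) :
    ∃ D, ∀ m, ExpIn (fun e => e (some k)) (Set.Iic D) (auxMul m p) := by
  induction p using MvPolynomial.induction_on' with
  | monomial d c =>
    refine ⟨d k, fun m e he => ?_⟩
    have h1 : monomial d c = c • monomial d (1 : ℂ) := by
      rw [smul_monomial, smul_eq_mul, mul_one]
    rw [h1, map_smul, coeff_smul] at he
    exact (expIn_auxMul d k m e (right_ne_zero_of_mul he)).le
  | add p q hp hq =>
    obtain ⟨D, hD⟩ := hp
    obtain ⟨D', hD'⟩ := hq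
    refine ⟨max D D', fun m e he => ?_⟩
    rw [map_add, coeff_add] at he
    by_cases h : coeff e (auxMul m p) = 0
    · exact Set.Iic_subset_Iic.2 (le_max_right _ _) (hD' m e (by simpa [h] using he))
    · exact Set.Iic_subset_Iic.2 (le_max_left _ _) (hD m e h)

theorem hasPartialTrace_monodromyMinus (hN : 0 < N) (u : ℂ) :
    HasPartialTrace (monodromyMinus l δ u) (Qminus l δ u) := by
  obtain ⟨k, t, hkt, hnd⟩ := exists_finRange_eq_cons hN
  rw [List.nodup_cons] at hnd
  refine hasPartialTrace_of_monomial fun d' => ?_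
  obtain ⟨D, hD⟩ := expIn_auxMul_Iic k (monomial d' 1)
  have h0 : ∀ (d : Fin N →₀ ℕ) m, D < m →
      coeff (d.optionElim m) (monodromyMinus l δ u (auxMul m (monomial d' 1))) = 0 := by
    intro d m hm
    rw [monodromyMinus_eq, hkt, List.map_cons, List.prod_cons]
    exact (caps_minus k _).coeff_eq_zero
      (Preserves.list_prod fun j hj => preserves_minus (ne_of_mem_of_not_mem hj hnd.1).symm _)
      (hD m) d hm
  refine ⟨∑ m ∈ Finset.range (D + 1), traceTerm (monodromyMinus l δ u) m (monomial d' 1),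
    fun d => ?_⟩
  rw [coeff_sum]
  refine hasSum_sum_of_ne_finset_zero fun m hm => ?_
  simp only [traceTerm_eq, coeff_auxCoeff]
  exact h0 d m (by simpa using hm)

/-- Each summand of the corner starts with a leftmost-site operator that bounds the power of `z_0`,
so the boundary terms are eventually zero. -/
theorem tendsto_cornerMinus (hN : 0 < N) (u : ℂ) (p : MvPolynomial (Fin N) ℂ) (d : Fin N →₀ ℕ) :
    Tendsto (fun m => coeff (Finsupp.optionElim m d) (cornerMinus l δ u (auxMul (m + 1) p))) atTop
      (𝓝 0) := by
  obtain ⟨k, t, hkt, hnd⟩ := exists_finRange_eq_cons hN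
  rw [List.nodup_cons] at hnd
  obtain ⟨D, hD⟩ := expIn_auxMul_Iic k p
  have hne : ∀ j ∈ t, k ≠ j := fun j hj e => hnd.1 (e ▸ hj)
  refine tendsto_const_nhds.congr' ?_
  filter_upwards [eventually_gt_atTop D] with m hm
  have h1 := ((caps_minus k (pochRatio (u + 1 + δ k + l k) (2 * l k))).smul
    (u + δ k + l k)).coeff_eq_zero (Preserves.corner (l := t)
      (α := fun k => (u + δ k + l k) • (permOp k * Rminus k (l k) (u + 1 + δ k)))
      (κ := fun k => -(permOp k * Rminus k (l k) (u + δ k) * del (some k)))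
      (β := fun k => (u + δ k - l k) • (permOp k * Rminus k (l k) (u - 1 + δ k)))
      (fun j hj => (preserves_minus (hne j hj) _).smul _)
      (fun j hj => ((preserves_minus (hne j hj) _).mul
        (preserves_del (by simpa using (hne j hj).symm))).neg)
      (fun j hj => (preserves_minus (hne j hj) _).smul _)) (hD (m + 1)) d hm
  have h2 := (caps_minus k (pochRatio (u + δ k + l k) (2 * l k))).neg_mul_del.coeff_eq_zero
    (Preserves.list_prod (l := t)
      (f := fun k => (u + δ k - l k) • (permOp k * Rminus k (l k) (u - 1 + δ k)))
      (fun j hj => (preserves_minus (hne j hj) _).smul _)) (hD (m + 1)) d hm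
  rw [cornerMinus, hkt, corner, LinearMap.add_apply, coeff_add]
  exact ((congrArg₂ (· + ·) h1 h2).trans (add_zero 0)).symm

theorem Qminus_mul_transferMatrix (hN : 0 < N) (hl : ∀ (k : Fin N) (n : ℕ), 2 * l k ≠ -(n : ℂ))
    (u : ℂ) : Qminus l δ u * transferMatrix l δ u =
      DeltaPlus l δ u • Qminus l δ (u + 1) + DeltaMinus l δ u • Qminus l δ (u - 1) :=
  trace_mul_transferMatrix (monodromyMinus_mul_transferMatrixExt l δ hl u)
    (hasPartialTrace_monodromyMinus hN u) (hasPartialTrace_monodromyMinus hN _)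
    (hasPartialTrace_monodromyMinus hN _) (tendsto_cornerMinus hN u)

end QMinus

/-! ### Existence of `Q₊` and its Baxter equation. -/

section QPlus

/-- The operators `R⁺_{k0}(u + δ_k)` are all defined. -/
def PlusRegular (u : ℂ) : Prop := ∀ (k : Fin N) (n : ℕ), 1 + l k - (u + δ k) ≠ -(n : ℂ)

theorem monodromyPlus_eq (u : ℂ) : monodromyPlus l δ u =
    ((List.finRange N).map fun k => permOp k * Rplus k (l k) (u + δ k)).prod := by
  rw [monodromyPlus, List.ofFn_eq_map]

/-- The off-diagonal part of the triangular form of `L R⁺`. -/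
noncomputable def cornerPlus (u : ℂ) : Module.End ℂ (Extended N) :=
  corner (fun k => ((u - 1 + δ k + l k) * (u + δ k - l k) / (u - 1 + δ k - l k)) •
      (permOp k * Rplus k (l k) (u - 1 + δ k)))
    (fun k => -(del (some k) * (permOp k * Rplus k (l k) (u + δ k))))
    (fun k => (u + δ k - l k) • (permOp k * Rplus k (l k) (u + 1 + δ k))) (List.finRange N)

theorem transferMatrixExt_mul_monodromyPlus {u : ℂ} (h0 : PlusRegular l δ u)
    (h1 : PlusRegular l δ (u + 1)) : transferMatrixExt l δ u * monodromyPlus l δ u =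
      (DeltaPlus l δ (u - 1) * DeltaMinus l δ u / DeltaMinus l δ (u - 1)) •
          monodromyPlus l δ (u - 1) + DeltaMinus l δ u • monodromyPlus l δ (u + 1) +
        (mulZ none * cornerPlus l δ u - cornerPlus l δ u * mulZ none) := by
  have hc : DeltaPlus l δ (u - 1) * DeltaMinus l δ u / DeltaMinus l δ (u - 1) =
      ∏ k, (u - 1 + δ k + l k) * (u + δ k - l k) / (u - 1 + δ k - l k) := by
    rw [Finset.prod_div_distrib, Finset.prod_mul_distrib, DeltaPlus, DeltaMinus, DeltaMinus]
  have key : ∀ k, lax (some k) (u + δ k + l k) (u + δ k - l k) *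
      Matrix.diagonal (fun _ => permOp k * Rplus k (l k) (u + δ k)) * lowerUni (mulZ none) =
      lowerUni (mulZ none) * upperTri
        (((u - 1 + δ k + l k) * (u + δ k - l k) / (u - 1 + δ k - l k)) •
          (permOp k * Rplus k (l k) (u - 1 + δ k)))
        (-(del (some k) * (permOp k * Rplus k (l k) (u + δ k))))
        ((u + δ k - l k) • (permOp k * Rplus k (l k) (u + 1 + δ k))) := by
    intro k
    set b := 1 + l k - (u + δ k) with hb
    have e1 : u + δ k + l k - (u + δ k - l k) = 2 * l k := by ring
    have e2 : 1 - (u + δ k - l k) = b := by rw [hb]; ring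
    have e3 : 1 + l k - (u + 1 + δ k) = b - 1 := by rw [hb]; ring
    have e4 : 1 + l k - (u - 1 + δ k) = b + 1 := by rw [hb]; ring
    have hb0 : ∀ n : ℕ, b ≠ -n := h0 k
    have hb1 : ∀ n : ℕ, b - 1 ≠ -n := fun n => e3 ▸ h1 k n
    -- `-b` is the factor of `Δ₋(u - 1)` at site `k`, so the division in the coefficient is genuine.
    have hbz : b ≠ 0 := by simpa using hb0 0
    have h := lax_mul_permOp_mul (k := k) (f := pochRatio (2 * l k) b)
      (g := fun n => ((u - 1 + δ k + l k) * (u + δ k - l k) / (u - 1 + δ k - l k)) *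
        pochRatio (2 * l k) (b + 1) n)
      (g' := fun n => (u + δ k - l k) * pochRatio (2 * l k) (b - 1) n)
      (up := u + δ k + l k) (um := u + δ k - l k)
      (fun n => by rw [e1, e2, pochRatio_rec _ hb0])
      (fun n => by
        have e5 : u - 1 + δ k - l k = -b := by rw [hb]; ring
        rw [pochRatio_add_one_right hb0, e5]
        field_simp
        rw [hb]
        ring)
      (fun n => by
        have := pochRatio_sub_one_right hb1 (2 * l k) n
        have e6 : u + δ k - l k = -(b - 1) := by rw [hb]; ring
        rw [e6]
        linear_combination this)
    rw [dilationFun_smul, dilationFun_smul, mul_smul_comm, mul_smul_comm, ← e3, ← e4] at h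
    exact h
  have h := trace_prod_mul_prod key (fun j k hjk => lax_commute_permOp_mul_plus hjk _ _ _)
    (List.nodup_finRange N)
  rw [prod_smul_finRange, prod_smul_finRange, ← hc] at h
  rw [monodromyPlus_eq, monodromyPlus_eq, monodromyPlus_eq]
  exact h

variable {l δ}

theorem PlusRegular.hasRate {u : ℂ} (h : PlusRegular l δ u) (k : Fin N) :
    HasRate (pochRatio (2 * l k) (1 + l k - (u + δ k))) fun m =>
      ‖pochRatio (1 + l k - (u + δ k) - 2 * l k) (1 + l k - (u + δ k)) m‖ :=
  hasRate_pochRatio (h k) _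

theorem PlusRegular.hasRate_of_eq {u v : ℂ} (h : PlusRegular l δ u) (hv : v = u - 1) (k : Fin N) :
    ∃ C : ℝ, ∀ᶠ m in atTop,
      ‖pochRatio (1 + l k - (u + δ k) - 2 * l k) (1 + l k - (u + δ k)) m‖ ≤
        C * ‖pochRatio (1 + l k - (v + δ k) - 2 * l k) (1 + l k - (v + δ k)) m‖ := by
  have e1 : 1 + l k - (v + δ k) - 2 * l k = 1 + l k - (u + δ k) - 2 * l k + 1 := by rw [hv]; ring
  have e2 : 1 + l k - (v + δ k) = 1 + l k - (u + δ k) + 1 := by rw [hv]; ring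
  rw [e1, e2]
  exact eventually_pochRatio_le (h k) _

theorem hasPartialTrace_monodromyPlus (hl : 1 / 2 < (∑ k, l k).re) {u : ℂ}
    (h : PlusRegular l δ u) : HasPartialTrace (monodromyPlus l δ u) (Qplus l δ u) := by
  refine hasPartialTrace_of_monomial fun d' => exists_coeffHasSum ?_ d' fun d => ?_
  · rw [monodromyPlus_eq]
    exact Preserves.list_prod fun k _ => preserves_totalDeg_plus k _
  · have hs : Summable fun m => ((List.finRange N).map fun k =>
        ‖pochRatio (1 + l k - (u + δ k) - 2 * l k) (1 + l k - (u + δ k)) m‖).prod := by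
      simp only [← Fin.prod_univ_def]
      refine summable_prod_norm_pochRatio h ?_
      rw [← Finset.mul_sum, two_mul, Complex.add_re]
      linarith
    rw [monodromyPlus_eq]
    exact (Decay.list_prod (fun k m => norm_nonneg _)
      (fun k => (h.hasRate k).stepRate (fun m => norm_nonneg _) k)
      (fun j k hjk => preserves_plus hjk _) (List.nodup_finRange N) (decay_auxMul d')
      (fun k => ⟨d' k, expIn_auxMul d' k⟩)).summable_coeff hs d

/-- The diagonal element at `z_0^m` with all other exponents zero factorizes over the sites, since
at each factor only one monomial contributes. -/
theorem coeff_list_prod_plus (f : Fin N → ℕ → ℂ) (m : ℕ) {t : List (Fin N)} (ht : t.Nodup) :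
    coeff (Finsupp.optionElim m 0) ((t.map fun k => permOp k * dilationFun none (some k) (f k)).prod
      (auxMul m (monomial 0 1))) = (t.map fun k => iterDiff (f k) 0 m).prod := by
  induction t with
  | nil =>
    rw [List.map_nil, List.prod_nil, List.map_nil, List.prod_nil, Module.End.one_apply,
      auxMul_monomial, coeff_monomial, if_pos rfl]
  | cons k t ih =>
    rw [List.nodup_cons] at ht
    have hp : Preserves (fun e => e (some k))
        (t.map fun k => permOp k * dilationFun none (some k) (f k)).prod :=
      Preserves.list_prod fun j hj => preserves_plus (ne_of_mem_of_not_mem hj ht.1).symm _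
    have h0 : (0 : Fin N →₀ ℕ).update k 0 = 0 := by
      ext j; simp
    rw [List.map_cons, List.prod_cons, Module.End.mul_apply,
      coeff_plus k (f k) (hp.expIn (expIn_auxMul 0 k m)) 0 m m (Nat.zero_le _) rfl]
    rw [Finsupp.coe_zero, Pi.zero_apply, h0, ih ht.2, Nat.choose_zero_right, Nat.cast_one, one_mul,
      Nat.sub_zero, List.map_cons, List.prod_cons]

/-- For `Ψ = 1` the constant coefficients of the trace terms have exactly these products as moduli,
and terms of a convergent series tend to zero. No assumption on `Re ∑ ℓ_k` is needed. -/
theorem tendsto_prod_of_hasPartialTrace {u : ℂ} (h : PlusRegular l δ u)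
    {Q : Module.End ℂ (MvPolynomial (Fin N) ℂ)} (hQ : HasPartialTrace (monodromyPlus l δ u) Q) :
    Tendsto (fun m => ((List.finRange N).map fun k =>
      ‖pochRatio (1 + l k - (u + δ k) - 2 * l k) (1 + l k - (u + δ k)) m‖).prod) atTop (𝓝 0) := by
  have h1 := (hQ (monomial 0 1) 0).summable.tendsto_atTop_zero
  rw [tendsto_zero_iff_norm_tendsto_zero] at h1
  refine h1.congr fun m => ?_
  rw [traceTerm_eq, coeff_auxCoeff, monodromyPlus_eq]
  refine (congrArg norm (coeff_list_prod_plus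
    (fun k => pochRatio (2 * l k) (1 + l k - (u + δ k))) m (List.nodup_finRange N))).trans ?_
  rw [← Fin.prod_univ_def, ← Fin.prod_univ_def, norm_prod]
  refine Finset.prod_congr rfl fun k _ => ?_
  rw [iterDiff_pochRatio (h k)]
  simp [pochRatio]

/-- The corner mixes factors at `u - 1`, `u` and `u + 1`. All are given the rate at `u - 1`, whose
product over the sites tends to zero because the trace exists there. -/
theorem tendsto_cornerPlus {u : ℂ} (hm : PlusRegular l δ (u - 1)) (h0 : PlusRegular l δ u)
    (h1 : PlusRegular l δ (u + 1)) {Q : Module.End ℂ (MvPolynomial (Fin N) ℂ)}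
    (hQ : HasPartialTrace (monodromyPlus l δ (u - 1)) Q) (p : MvPolynomial (Fin N) ℂ)
    (d : Fin N →₀ ℕ) :
    Tendsto (fun m => coeff (Finsupp.optionElim m d) (cornerPlus l δ u (auxMul (m + 1) p))) atTop
      (𝓝 0) := by
  refine tendsto_coeff_of_monomial (fun d' d => ?_) p d
  have hr0 : ∀ k, HasRate (pochRatio (2 * l k) (1 + l k - (u + δ k))) _ := fun k =>
    (h0.hasRate k).mono (fun _ => norm_nonneg _) (h0.hasRate_of_eq rfl k)
  -- Two comparisons in succession, from `u + 1` to `u` and from `u` to `u - 1`.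
  have hr1 : ∀ k, HasRate (pochRatio (2 * l k) (1 + l k - (u + 1 + δ k))) _ := fun k =>
    ((h1.hasRate k).mono (fun _ => norm_nonneg _)
      (h1.hasRate_of_eq (v := u) (by ring) k)).mono (fun _ => norm_nonneg _)
        (h0.hasRate_of_eq rfl k)
  exact (Decay.corner (fun k m => norm_nonneg _)
    (fun k => ((hm.hasRate k).stepRate (fun m => norm_nonneg _) k).smul _)
    (fun k => ((hr0 k).stepRate (fun m => norm_nonneg _) k).del_neg)
    (fun k => ((hr1 k).stepRate (fun m => norm_nonneg _) k).smul _)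
    (fun j k hjk => (preserves_plus hjk _).smul _)
    (fun j k hjk => ((preserves_del (by simpa using hjk.symm)).mul (preserves_plus hjk _)).neg)
    (fun j k hjk => (preserves_plus hjk _).smul _) (List.nodup_finRange N) (decay_auxMul d')
    (fun k => ⟨d' k, expIn_auxMul d' k⟩)).tendsto_coeff (tendsto_prod_of_hasPartialTrace hm hQ) d

theorem transferMatrix_mul_Qplus {u : ℂ} (h : ∀ v ∈ ({u - 1, u, u + 1} : Set ℂ),
    PlusRegular l δ v ∧ HasPartialTrace (monodromyPlus l δ v) (Qplus l δ v)) :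
    transferMatrix l δ u * Qplus l δ u =
      (DeltaPlus l δ (u - 1) * DeltaMinus l δ u / DeltaMinus l δ (u - 1)) • Qplus l δ (u - 1) +
        DeltaMinus l δ u • Qplus l δ (u + 1) := by
  obtain ⟨rm, tm⟩ := h (u - 1) (by simp)
  obtain ⟨r0, t0⟩ := h u (by simp)
  obtain ⟨r1, t1⟩ := h (u + 1) (by simp)
  exact transferMatrix_mul_trace (transferMatrixExt_mul_monodromyPlus l δ r0 r1) t0 tm t1
    (tendsto_cornerPlus rm r0 r1 tm)

end QPlus

end SpinChain

theorem proposition7 (N : ℕ) (hN : 0 < N) (l δ : Fin N → ℂ)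
    (hl : ∀ (k : Fin N) (n : ℕ), 2 * l k ≠ -(n : ℂ)) :
    -- the trace defining `Q₋` always exists, and `Q₋` obeys the Baxter equation
    (∀ u : ℂ, SpinChain.HasPartialTrace (SpinChain.monodromyMinus l δ u)
        (SpinChain.Qminus l δ u)) ∧
    (∀ u : ℂ, SpinChain.Qminus l δ u * SpinChain.transferMatrix l δ u =
        SpinChain.DeltaPlus l δ u • SpinChain.Qminus l δ (u + 1) +
        SpinChain.DeltaMinus l δ u • SpinChain.Qminus l δ (u - 1)) ∧
    -- off the poles of `R⁺`, the trace defining `Q₊` exists when `Re ∑ ℓ_k > 1/2`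
    (1 / 2 < (∑ k, l k).re → ∀ u : ℂ, (∀ (k : Fin N) (n : ℕ), 1 + l k - (u + δ k) ≠ -(n : ℂ)) →
        SpinChain.HasPartialTrace (SpinChain.monodromyPlus l δ u) (SpinChain.Qplus l δ u)) ∧
    -- where `Q₊(u - 1)`, `Q₊(u)`, `Q₊(u + 1)` are defined, `Q₊` obeys the Baxter equation
    (∀ u : ℂ, (∀ v ∈ ({u - 1, u, u + 1} : Set ℂ),
          (∀ (k : Fin N) (n : ℕ), 1 + l k - (v + δ k) ≠ -(n : ℂ)) ∧
          SpinChain.HasPartialTrace (SpinChain.monodromyPlus l δ v) (SpinChain.Qplus l δ v)) →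
        SpinChain.transferMatrix l δ u * SpinChain.Qplus l δ u =
        (SpinChain.DeltaPlus l δ (u - 1) * SpinChain.DeltaMinus l δ u /
            SpinChain.DeltaMinus l δ (u - 1)) • SpinChain.Qplus l δ (u - 1) +
        SpinChain.DeltaMinus l δ u • SpinChain.Qplus l δ (u + 1)) :=
  ⟨SpinChain.hasPartialTrace_monodromyMinus hN, SpinChain.Qminus_mul_transferMatrix hN hl,
    fun h _ hu => SpinChain.hasPartialTrace_monodromyPlus h hu,
    fun _ hu => SpinChain.transferMatrix_mul_Qplus hu⟩
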